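/- For a Borel probability measure $\mu$ on $\mathbb{C}$ with compact support let $I(\mu)=\iint -\log|z-w|\,d\mu(z)\,d\mu(w)\in(-\infty,+\infty]$, and for $E\subseteq\mathbb{C}$ let $\mathrm{Cap}(E)=\exp(-\inf_\mu I(\mu))$ be its logarithmic capacity, where the infimum is over all Borel probability measures $\mu$ whose support is a compact subset of $E$, and $e^{-\infty}=0$. \begin{theorem} Let $J\subset\mathbb{R}$ be a bounded interval with more than one point (open, closed or half-open; for example $J=[0,1]$). Let $c_0,c_1,c_2,\dots$ be independent, identically distributed real random variables whose common law is absolutely continuous on $J$, that is, of the form $f(x)\,dx|_J$, with a density $f$ that satisfies $0<f(x)\le M$ for Lebesgue-almost every $x\in J$ and some constant $M$. Fix $\lambda>0$, put $l_k=e^{-\lambda k}$, let $I_k=(c_k-l_k/2,\;c_k+l_k/2)$ be the open interval with center $c_k$ and length $l_k$, and let $$S=\bigcap_{m}\bigcup_{k\ge m}I_k .$$ Then, almost surely, $S$ has full capacity on $J$: $$S\subseteq J\qquad\text{and}\qquad \mathrm{Cap}(S)=\mathrm{Cap}(J)>0 .$$ In particular, for $J=[0,1]$, almost surely $\mathrm{Cap}(S)=\mathrm{Cap}([0,1])>0$.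 \end{theorem} -/

import Mathlib

open MeasureTheory ProbabilityTheory

/-- The logarithmic kernel `-log |z - w|`, with the value `+∞` on the diagonal
(`ENNReal.log 0 = ⊥`). -/
noncomputable def logKernel (z w : ℂ) : EReal := -ENNReal.log (edist z w)

/-- The logarithmic energy `I(μ) = ∬ -log |z - w| dμ(z) dμ(w)`, as the integral of the positive part
of the kernel minus the integral of its negative part. For a finite measure with compact support
the second integral is finite, so that `I(μ)` is a well-defined element of `(-∞, +∞]`. -/
noncomputable def logEnergy (μ : Measure ℂ) : EReal :=
  ((∫⁻ z, ∫⁻ w, (logKernel z w).toENNReal ∂μ ∂μ : ENNReal) : EReal) -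
    ((∫⁻ z, ∫⁻ w, (-logKernel z w).toENNReal ∂μ ∂μ : ENNReal) : EReal)

/-- The logarithmic capacity `Cap(E) = exp (-inf I(μ))`, the infimum being over the Borel probability
measures on `ℂ` whose support is a compact subset of `E`, with `exp (-∞) = 0`. -/
noncomputable def logCapacity (E : Set ℂ) : ENNReal :=
  EReal.exp (-(⨅ μ ∈ {μ : Measure ℂ | IsProbabilityMeasure μ ∧
    IsCompact μ.support ∧ μ.support ⊆ E}, logEnergy μ))

/-- `E` has full capacity on `J`: it is a subset of `J` with the same capacity as `J`. -/
def HasFullCapacity (E J : Set ℂ) : Prop :=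
  E ⊆ J ∧ logCapacity E = logCapacity J

/-- The set `⋂ m, ⋃ k ≥ m, I k`, where `I k` is the open interval with center `c k` and
length `l k`. -/
def limsupIntervals (c l : ℕ → ℝ) : Set ℝ :=
  ⋂ m : ℕ, ⋃ k ≥ m, Set.Ioo (c k - l k / 2) (c k + l k / 2)

/-! Put κ(t) = log⁺(R / |t|) with R = e (diam J + 1). For measures on J the logarithmic energy is
the κ-energy minus log R. Let V be the minimal κ-energy on J. It suffices that, almost surely, S
lies in J and carries probability measures of κ-energy arbitrarily close to V.

A nearly optimal measure on J is first replaced by some ν of bounded density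
(`exists_bounded_density_posLogEnergy_lt`), concentrated where the law ρ of the centers gives balls
of radius l_k / 4 mass at least l_k / (m + 1) (`exists_lowerDensitySet_posLogEnergy_lt`). Then ν is
multiplied by random densities, one for each of a sequence of consecutive blocks of indices. The
density of a block is Σ w_k h_k with Σ w_k = 1, where h_k(x) is the indicator of |c_k - x| ≤ l_k / 4
divided by its mean. It has mean one, and by independence its correlation at x, y exceeds one by at
most Σ w_k² (m + 1) / l_k over those k with |x - y| ≤ l_k / 2.

Since log(1 / l_k) grows linearly in k, the integral of κ over |t| ≤ l_k / 2 is O(k l_k), so this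
excess costs energy O(Σ w_k² k). With w_k proportional to 1/k the cost is O(1 / Σ 1/k), which is
arbitrarily small for long blocks because the harmonic series diverges (`exists_blocks`).

Hence the random measure has mass M with mean 1 and second moment at most 1 + ε, and its energy E
has mean at most V + 2ε. As E ≥ V M² always holds on J, Markov's inequality for E - V M² and
Chebyshev's inequality for M make E / M² close to V with high probability, at every stage. With high
probability this happens at infinitely many stages, and weak compactness with lower semicontinuity
of energy then gives a measure on the limiting compact set, which lies in S
(`measure_not_exists_posLogEnergy_le`). Letting ε tend to 0 makes the statement almost sure. The
inclusion of S in J is Borel–Cantelli at the two endpoints. -/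

open scoped ENNReal NNReal Topology
open Filter Set

/-! ### The positive logarithmic kernel -/

/-- The nonnegative logarithmic kernel `log⁺ (R / |t|)`, infinite at `t = 0`. -/
noncomputable def posLogKernel (R t : ℝ) : ℝ≥0∞ :=
  if t = 0 then ⊤ else ENNReal.ofReal (Real.log (R / |t|))

/-- The energy of a measure on the line with respect to `posLogKernel R`. -/
noncomputable def posLogEnergy (R : ℝ) (μ : Measure ℝ) : ℝ≥0∞ :=
  ∫⁻ x, ∫⁻ y, posLogKernel R (x - y) ∂μ ∂μ

@[simp] lemma posLogKernel_zero (R : ℝ) : posLogKernel R 0 = ⊤ := if_pos rfl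

lemma posLogKernel_of_ne {R t : ℝ} (ht : t ≠ 0) :
    posLogKernel R t = ENNReal.ofReal (Real.log (R / |t|)) := if_neg ht

@[fun_prop] lemma measurable_posLogKernel (R : ℝ) : Measurable (posLogKernel R) := by
  unfold posLogKernel
  refine Measurable.ite (measurableSet_singleton 0) measurable_const ?_
  fun_prop

lemma posLogKernel_le_of_abs_le {R s t : ℝ} (hR : 0 < R) (h : |t| ≤ |s|) :
    posLogKernel R s ≤ posLogKernel R t := by
  rcases eq_or_ne t 0 with rfl | ht
  · simp
  have ht' : 0 < |t| := abs_pos.2 ht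
  have hs' : 0 < |s| := ht'.trans_le h
  rw [posLogKernel_of_ne ht, posLogKernel_of_ne (abs_pos.1 hs')]
  gcongr

lemma posLogKernel_add_le {R r t : ℝ} (hr : 0 < r) (hR : 0 < R) :
    posLogKernel R t ≤ ENNReal.ofReal (Real.log (R / r)) + posLogKernel r t := by
  rcases eq_or_ne t 0 with rfl | ht
  · simp
  have ht' : 0 < |t| := abs_pos.2 ht
  rw [posLogKernel_of_ne ht, posLogKernel_of_ne ht]
  refine le_trans (ENNReal.ofReal_le_ofReal (le_of_eq ?_)) ENNReal.ofReal_add_le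
  rw [← Real.log_mul (by positivity) (by positivity)]
  congr 1
  field_simp

lemma posLogKernel_eq_zero {r t : ℝ} (hr : 0 < r) (ht : r ≤ |t|) : posLogKernel r t = 0 := by
  have ht' : 0 < |t| := hr.trans_le ht
  rw [posLogKernel_of_ne (abs_pos.1 ht'), ENNReal.ofReal_eq_zero]
  exact Real.log_nonpos (by positivity) (by rwa [div_le_one ht'])

lemma lintegral_posLogKernel {r : ℝ} (hr : 0 < r) :
    ∫⁻ t, posLogKernel r t = ENNReal.ofReal (2 * r) := by
  -- `Real.log` is even, so `log r - log t` is the right formula for negative `t` as well.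
  have h1 : ∫⁻ t, posLogKernel r t = ∫⁻ t in Ioc (-r) r, ENNReal.ofReal (Real.log r - Real.log t) := by
    rw [← lintegral_indicator measurableSet_Ioc]
    refine lintegral_congr_ae ?_
    filter_upwards [compl_mem_ae_iff.2 (measure_singleton (μ := volume) (0 : ℝ))] with t ht
    have ht0 : t ≠ 0 := ht
    by_cases htr : t ∈ Ioc (-r) r
    · rw [indicator_of_mem htr, posLogKernel_of_ne ht0, Real.log_div hr.ne' (abs_ne_zero.2 ht0),
        Real.log_abs]
    · rw [indicator_of_notMem htr]
      refine posLogKernel_eq_zero hr ?_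
      rw [mem_Ioc, not_and_or, not_lt, not_le] at htr
      rcases htr with h | h
      · exact le_abs.2 (Or.inr (by linarith))
      · exact le_abs.2 (Or.inl h.le)
  have hint : IntervalIntegrable (fun t => Real.log r - Real.log t) volume (-r) r :=
    intervalIntegrable_const.sub intervalIntegral.intervalIntegrable_log'
  have hle : -r ≤ r := by linarith
  rw [h1, ← ofReal_integral_eq_lintegral_ofReal
    ((intervalIntegrable_iff_integrableOn_Ioc_of_le hle).1 hint), ← intervalIntegral.integral_of_le hle,
    intervalIntegral.integral_sub intervalIntegrable_const intervalIntegral.intervalIntegrable_log',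
    integral_log]
  · congr 1
    simp
    ring
  · refine (ae_restrict_iff' measurableSet_Ioc).2 ?_
    filter_upwards [compl_mem_ae_iff.2 (measure_singleton (μ := volume) (0 : ℝ))] with t ht htr
    have ht0 : t ≠ 0 := ht
    have : Real.log t ≤ Real.log r := by
      rw [← Real.log_abs t]
      exact Real.log_le_log (abs_pos.2 ht0) (abs_le.2 ⟨htr.1.le, htr.2⟩)
    simpa using this

/-! ### Lower semicontinuity of the energy and weak limits -/

/-- Bounded continuous truncation of `posLogKernel R`, as a function of two variables. -/
noncomputable def truncLogKernel (R : ℝ) (hR : 0 < R) (n : ℕ) :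
    BoundedContinuousFunction (ℝ × ℝ) ℝ≥0 :=
  BoundedContinuousFunction.mkOfBound
    ⟨fun p => (Real.log (R / max |p.1 - p.2| (1 / (n + 1)))).toNNReal, by
      refine continuous_real_toNNReal.comp (Continuous.log ?_ ?_)
      · refine Continuous.div continuous_const (by fun_prop) fun p => ?_
        have : (0 : ℝ) < 1 / (n + 1) := by positivity
        exact (lt_max_of_lt_right this).ne'
      · intro p
        have : (0 : ℝ) < max |p.1 - p.2| (1 / (n + 1)) := lt_max_of_lt_right (by positivity)
        positivity⟩
    (Real.log (R / (1 / (n + 1)))).toNNReal (by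
      have key : ∀ p : ℝ × ℝ, (Real.log (R / max |p.1 - p.2| (1 / (n + 1)))).toNNReal ≤
          (Real.log (R / (1 / (n + 1)))).toNNReal := by
        intro p
        have : (0 : ℝ) < max |p.1 - p.2| (1 / (n + 1)) := lt_max_of_lt_right (by positivity)
        refine Real.toNNReal_le_toNNReal (Real.log_le_log (by positivity) ?_)
        gcongr
        exact le_max_right _ _
      intro p q
      rw [NNReal.dist_eq]
      have h1 : ((Real.log (R / max |p.1 - p.2| (1 / (n + 1)))).toNNReal : ℝ) ≤
        ((Real.log (R / (1 / (n + 1)))).toNNReal : ℝ) := by exact_mod_cast key p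
      have h2 : ((Real.log (R / max |q.1 - q.2| (1 / (n + 1)))).toNNReal : ℝ) ≤
        ((Real.log (R / (1 / (n + 1)))).toNNReal : ℝ) := by exact_mod_cast key q
      refine abs_le.2 ⟨?_, ?_⟩ <;>
      simp only [ContinuousMap.coe_mk] <;>
      nlinarith [NNReal.coe_nonneg (Real.log (R / max |p.1 - p.2| (1 / (n + 1)))).toNNReal,
        NNReal.coe_nonneg (Real.log (R / max |q.1 - q.2| (1 / (n + 1)))).toNNReal])

lemma truncLogKernel_apply {R : ℝ} (hR : 0 < R) (n : ℕ) (p : ℝ × ℝ) :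
    (truncLogKernel R hR n p : ℝ≥0∞) =
      ENNReal.ofReal (Real.log (R / max |p.1 - p.2| (1 / (n + 1)))) := rfl

lemma iSup_truncLogKernel {R : ℝ} (hR : 0 < R) (p : ℝ × ℝ) :
    ⨆ n, (truncLogKernel R hR n p : ℝ≥0∞) = posLogKernel R (p.1 - p.2) := by
  simp only [truncLogKernel_apply]
  rcases eq_or_ne (p.1 - p.2) 0 with h | h
  · simp only [h, abs_zero, posLogKernel_zero]
    rw [iSup_eq_top]
    intro b hb
    lift b to ℝ≥0 using hb.ne
    have ht : Tendsto (fun n : ℕ => Real.log (R * ((n : ℝ) + 1))) atTop atTop := by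
      refine Real.tendsto_log_atTop.comp (Tendsto.const_mul_atTop hR ?_)
      exact tendsto_atTop_add_const_right _ _ tendsto_natCast_atTop_atTop
    obtain ⟨n, hn⟩ := (ht.eventually_gt_atTop (b : ℝ)).exists
    refine ⟨n, ?_⟩
    have h0 : max 0 (1 / ((n : ℝ) + 1)) = 1 / ((n : ℝ) + 1) := max_eq_right (by positivity)
    rw [h0, div_div_eq_mul_div, div_one]
    rw [← ENNReal.ofReal_coe_nnreal]
    exact (ENNReal.ofReal_lt_ofReal_iff (b.coe_nonneg.trans_lt hn)).2 hn
  · rw [posLogKernel_of_ne h]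
    have hp := abs_pos.2 h
    apply le_antisymm
    · refine iSup_le fun n => ?_
      gcongr
      exact le_max_left _ _
    · obtain ⟨n, hn⟩ := exists_nat_one_div_lt hp
      refine le_iSup_of_le n ?_
      rw [max_eq_left hn.le]

lemma monotone_truncLogKernel {R : ℝ} (hR : 0 < R) (p : ℝ × ℝ) :
    Monotone fun n => (truncLogKernel R hR n p : ℝ≥0∞) := by
  intro m n hmn
  simp only [truncLogKernel_apply]
  have h1 : (0 : ℝ) < max |p.1 - p.2| (1 / (n + 1)) := lt_max_of_lt_right (by positivity)
  have h2 : (0 : ℝ) < max |p.1 - p.2| (1 / (m + 1)) := lt_max_of_lt_right (by positivity)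
  gcongr

lemma posLogEnergy_eq_lintegral_prod (R : ℝ) (μ : Measure ℝ) [SFinite μ] :
    posLogEnergy R μ = ∫⁻ p, posLogKernel R (p.1 - p.2) ∂(μ.prod μ) := by
  rw [lintegral_prod _ (by fun_prop)]
  rfl

/-- Lower semicontinuity: the energy is the supremum of the integrals of the bounded continuous
truncations against `μ.prod μ`, and each of these is weakly continuous in `μ`. -/
lemma isClosed_setOf_posLogEnergy_le {R : ℝ} (hR : 0 < R) (c : ℝ≥0∞) :
    IsClosed {μ : ProbabilityMeasure ℝ | posLogEnergy R μ ≤ c} := by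
  have : {μ : ProbabilityMeasure ℝ | posLogEnergy R μ ≤ c} =
      ⋂ n, {μ : ProbabilityMeasure ℝ |
        ∫⁻ p, truncLogKernel R hR n p ∂(μ.prod μ : ProbabilityMeasure (ℝ × ℝ)) ≤ c} := by
    ext μ
    have h : posLogEnergy R μ = ⨆ n,
        ∫⁻ p, truncLogKernel R hR n p ∂(μ.prod μ : ProbabilityMeasure (ℝ × ℝ)) := by
      rw [posLogEnergy_eq_lintegral_prod, ProbabilityMeasure.toMeasure_prod, ← lintegral_iSup]
      · simp only [iSup_truncLogKernel]
      · intro n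
        exact (truncLogKernel R hR n).continuous.measurable.coe_nnreal_ennreal
      · intro m n hmn p
        exact monotone_truncLogKernel hR p hmn
    simp only [mem_ofPred_eq, h, iSup_le_iff, mem_iInter]
  rw [this]
  refine isClosed_iInter fun n => ?_
  refine isClosed_le ?_ continuous_const
  exact (ProbabilityMeasure.continuous_lintegral_boundedContinuousFunction _).comp
    (ProbabilityMeasure.continuous_prod.comp (continuous_id.prodMk continuous_id))

/-- Probability measures of bounded energy on a decreasing sequence of compact sets yield one on
the intersection. -/
lemma exists_posLogEnergy_le_iInter {R : ℝ} (hR : 0 < R) (c : ℝ≥0∞) {K : ℕ → Set ℝ}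
    (hK : ∀ i, IsCompact (K i)) (hanti : Antitone K)
    (h : ∃ᶠ i in atTop, ∃ μ : Measure ℝ, IsProbabilityMeasure μ ∧ μ (K i)ᶜ = 0 ∧
      posLogEnergy R μ ≤ c) :
    ∃ μ : Measure ℝ, IsProbabilityMeasure μ ∧ μ (⋂ i, K i)ᶜ = 0 ∧ posLogEnergy R μ ≤ c := by
  -- The vacuous quantifier over `ℕ` gives the support condition the shape of a tightness condition
  -- with constant bound 0, to which Prokhorov's theorem applies.
  let C : ℕ → Set (ProbabilityMeasure ℝ) := fun i =>
    {μ : ProbabilityMeasure ℝ | ∀ _ : ℕ, μ (K i)ᶜ ≤ 0} ∩ {μ | posLogEnergy R μ ≤ c}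
  have hcomp : ∀ i, IsCompact {μ : ProbabilityMeasure ℝ | ∀ _ : ℕ, μ (K i)ᶜ ≤ 0} := fun i =>
    isCompact_setOfPred_probabilityMeasure_mass_eq_compl_isCompact_le (u := fun _ => 0)
      (K := fun _ => K i) tendsto_const_nhds (fun _ => hK i) (Or.inl inferInstance)
  have hC : ∀ i, IsCompact (C i) := fun i =>
    (hcomp i).inter_right (isClosed_setOf_posLogEnergy_le hR c)
  have hne : (⋂ i, C i).Nonempty := by
    refine IsCompact.nonempty_iInter_of_sequence_nonempty_isCompact_isClosed C ?_ ?_ (hC 0)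
      fun i => (hC i).isClosed
    · rintro i μ ⟨h1, h2⟩
      refine ⟨fun n => le_trans ?_ (h1 n), h2⟩
      exact μ.apply_mono (compl_subset_compl.2 (hanti i.le_succ))
    · intro i
      obtain ⟨j, hij, μ, hμ, h1, h2⟩ := (frequently_atTop.1 h) i
      refine ⟨⟨μ, hμ⟩, fun _ => ?_, h2⟩
      have h3 : μ (K i)ᶜ = 0 := measure_mono_null (compl_subset_compl.2 (hanti hij)) h1
      exact ((ProbabilityMeasure.null_iff_toMeasure_null ⟨μ, hμ⟩ _).2 h3).le
  obtain ⟨μ, hμ⟩ := hne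
  rw [mem_iInter] at hμ
  refine ⟨μ, inferInstance, ?_, (hμ 0).2⟩
  rw [compl_iInter, measure_iUnion_null_iff]
  intro i
  rw [← ProbabilityMeasure.null_iff_toMeasure_null]
  exact le_antisymm ((hμ i).1 0) bot_le

/-! ### Capacity of subsets of the line through the positive kernel -/

lemma EReal.coe_ennreal_sub_eq_of_add_eq {a b c d : ℝ≥0∞} (hb : b ≠ ⊤) (hd : d ≠ ⊤)
    (h : a + d = c + b) : (a : EReal) - b = (c : EReal) - d := by
  lift b to ℝ≥0 using hb
  lift d to ℝ≥0 using hd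
  rcases eq_or_ne a ⊤ with rfl | ha
  · have hc : c = ⊤ := by
      by_contra hc
      exact (ENNReal.add_ne_top.2 ⟨hc, ENNReal.coe_ne_top⟩) (by rw [← h]; simp)
    subst hc
    rw [EReal.coe_ennreal_top]
    rfl
  · have hc : c ≠ ⊤ := by
      rintro rfl
      exact (ENNReal.add_ne_top.2 ⟨ha, ENNReal.coe_ne_top⟩) (by rw [h]; simp)
    lift a to ℝ≥0 using ha
    lift c to ℝ≥0 using hc
    have h' : (a : ℝ) + d = c + b := by exact_mod_cast h
    have h2 : (a : ℝ) - b = c - d := by linarith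
    exact congrArg (fun x : ℝ => (x : EReal)) h2

/-- This is `-log |x - y| + log R = log (R / |x - y|)` with the negative part moved to the other
side, so that no subtraction occurs in `ℝ≥0∞`; on the diagonal both sides are infinite. -/
lemma toENNReal_logKernel_add {R : ℝ} (hR : 1 ≤ R) {x y : ℝ} (h : |x - y| ≤ R) :
    (logKernel x y).toENNReal + ENNReal.ofReal (Real.log R) =
      posLogKernel R (x - y) + (-logKernel x y).toENNReal := by
  have he : edist (x : ℂ) y = ENNReal.ofReal |x - y| := by
    rw [edist_dist, Complex.dist_eq, ← Complex.ofReal_sub, Complex.norm_real, Real.norm_eq_abs]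
  unfold logKernel
  rw [he]
  rcases eq_or_ne (x - y) 0 with h0 | h0
  · simp [h0]
  have h1 : 0 < |x - y| := abs_pos.2 h0
  rw [ENNReal.log_ofReal, if_neg (not_le.2 h1), posLogKernel_of_ne h0, neg_neg, ← EReal.coe_neg,
    EReal.toENNReal_of_ne_top (EReal.coe_ne_top _), EReal.toENNReal_of_ne_top (EReal.coe_ne_top _),
    EReal.toReal_coe, EReal.toReal_coe, Real.log_div (by positivity) h1.ne']
  have hlR : 0 ≤ Real.log R := Real.log_nonneg hR
  have hle : Real.log |x - y| ≤ Real.log R := Real.log_le_log h1 h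
  rcases le_total 0 (Real.log |x - y|) with h2 | h2
  · rw [ENNReal.ofReal_of_nonpos (by linarith : -Real.log |x - y| ≤ 0), zero_add,
      ← ENNReal.ofReal_add (by linarith) h2]
    congr 1
    ring
  · rw [ENNReal.ofReal_of_nonpos h2, add_zero, ← ENNReal.ofReal_add (by linarith) hlR]
    congr 1
    ring

lemma measurable_logKernel_ofReal : Measurable fun p : ℝ × ℝ => logKernel p.1 p.2 := by
  unfold logKernel
  exact (ENNReal.measurable_log.comp (by fun_prop)).neg

lemma measurable_toENNReal_neg_logKernel (x : ℝ) :
    Measurable fun y : ℝ => (-logKernel x y).toENNReal := by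
  unfold logKernel
  refine Measurable.ereal_toENNReal (Measurable.neg (Measurable.neg ?_))
  exact ENNReal.measurable_log.comp (by fun_prop)

lemma toENNReal_neg_logKernel_le {R : ℝ} {x y : ℝ} (h : |x - y| ≤ R) :
    (-logKernel x y).toENNReal ≤ ENNReal.ofReal (Real.log R) := by
  have he : edist (x : ℂ) y = ENNReal.ofReal |x - y| := by
    rw [edist_dist, Complex.dist_eq, ← Complex.ofReal_sub, Complex.norm_real, Real.norm_eq_abs]
  unfold logKernel
  rw [he, neg_neg]
  rcases eq_or_ne (x - y) 0 with h0 | h0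
  · simp [h0]
  have h1 : 0 < |x - y| := abs_pos.2 h0
  rw [ENNReal.log_ofReal, if_neg (not_le.2 h1), EReal.toENNReal_of_ne_top (EReal.coe_ne_top _),
    EReal.toReal_coe]
  gcongr

lemma logEnergy_map_ofReal {R : ℝ} (hR : 1 ≤ R) (μ : Measure ℝ) [IsProbabilityMeasure μ]
    (h : ∀ᵐ x ∂μ, ∀ᵐ y ∂μ, |x - y| ≤ R) :
    logEnergy (μ.map Complex.ofReal) =
      (posLogEnergy R μ : EReal) - ((ENNReal.ofReal (Real.log R) : ℝ≥0∞) : EReal) := by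
  unfold logEnergy
  simp only [Complex.isometry_ofReal.isClosedEmbedding.measurableEmbedding.lintegral_map]
  have hm2 : Measurable fun p : ℝ × ℝ => (-logKernel p.1 p.2).toENNReal :=
    measurable_logKernel_ofReal.neg.ereal_toENNReal
  apply EReal.coe_ennreal_sub_eq_of_add_eq
  · refine ne_top_of_le_ne_top (b := ENNReal.ofReal (Real.log R)) ENNReal.ofReal_ne_top ?_
    calc _ ≤ ∫⁻ _, ∫⁻ _, ENNReal.ofReal (Real.log R) ∂μ ∂μ := by
          refine lintegral_mono_ae ?_
          filter_upwards [h] with x hx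
          refine lintegral_mono_ae ?_
          filter_upwards [hx] with y hy
          exact toENNReal_neg_logKernel_le hy
      _ = _ := by simp
  · exact ENNReal.ofReal_ne_top
  · have h1 : ENNReal.ofReal (Real.log R) = ∫⁻ _, ∫⁻ _, ENNReal.ofReal (Real.log R) ∂μ ∂μ := by simp
    rw [h1, posLogEnergy, ← lintegral_add_right _ measurable_const,
      ← lintegral_add_right _ hm2.lintegral_prod_right']
    refine lintegral_congr_ae ?_
    filter_upwards [h] with x hx
    have hm3 := measurable_toENNReal_neg_logKernel x
    rw [← lintegral_add_right _ measurable_const, ← lintegral_add_right _ hm3]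
    refine lintegral_congr_ae ?_
    filter_upwards [hx] with y hy
    exact toENNReal_logKernel_add hR hy

/-- The probability measures on the line concentrated on a compact subset of `J`. -/
def compactProbMeasures (J : Set ℝ) : Set (Measure ℝ) :=
  {μ | IsProbabilityMeasure μ ∧ ∃ K, IsCompact K ∧ K ⊆ J ∧ μ Kᶜ = 0}

lemma compactProbMeasures_mono {S J : Set ℝ} (h : S ⊆ J) :
    compactProbMeasures S ⊆ compactProbMeasures J := by
  rintro μ ⟨h1, K, hK, hKS, h2⟩
  exact ⟨h1, K, hK, hKS.trans h, h2⟩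

lemma ae_ae_abs_sub_le {R : ℝ} {J : Set ℝ} (hJ : ∀ x ∈ J, ∀ y ∈ J, |x - y| ≤ R) {μ : Measure ℝ}
    (hμ : μ ∈ compactProbMeasures J) : ∀ᵐ x ∂μ, ∀ᵐ y ∂μ, |x - y| ≤ R := by
  obtain ⟨_, K, hK, hKJ, h2⟩ := hμ
  have h3 : ∀ᵐ x ∂μ, x ∈ K := h2
  filter_upwards [h3] with x hx
  filter_upwards [h3] with y hy
  exact hJ x (hKJ hx) y (hKJ hy)

/-- The inclusion of the line and the real part transport the competing measures back and forth, and
subtracting a finite constant commutes with infima, being monotone and continuous. -/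
lemma iInf_logEnergy_image_ofReal {R : ℝ} (hR : 1 ≤ R) {J : Set ℝ}
    (hJ : ∀ x ∈ J, ∀ y ∈ J, |x - y| ≤ R) :
    ⨅ μ ∈ {μ : Measure ℂ | IsProbabilityMeasure μ ∧
      IsCompact μ.support ∧ μ.support ⊆ Complex.ofReal '' J}, logEnergy μ =
    ((⨅ μ ∈ compactProbMeasures J, posLogEnergy R μ : ℝ≥0∞) : EReal) -
      ((ENNReal.ofReal (Real.log R) : ℝ≥0∞) : EReal) := by
  set c : EReal := ((ENNReal.ofReal (Real.log R) : ℝ≥0∞) : EReal) with hc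
  have hctop : c ≠ ⊤ := by simp [hc]
  have hcbot : c ≠ ⊥ := by simp [hc]
  have hmap : ((⨅ μ ∈ compactProbMeasures J, posLogEnergy R μ : ℝ≥0∞) : EReal) - c =
      ⨅ μ ∈ compactProbMeasures J, ((posLogEnergy R μ : EReal) - c) := by
    have hmono : Monotone fun x : ℝ≥0∞ => (x : EReal) - c := fun x y hxy =>
      EReal.sub_le_sub (EReal.coe_ennreal_le_coe_ennreal_iff.2 hxy) le_rfl
    have hcont : Continuous fun x : ℝ≥0∞ => (x : EReal) - c := by
      refine continuous_iff_continuousAt.2 fun x => ?_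
      have h1 : ContinuousAt (fun p : EReal × EReal => p.1 + p.2) ((x : EReal), -c) :=
        EReal.continuousAt_add (Or.inr (by simpa using hctop)) (Or.inr (by simpa using hcbot))
      exact h1.comp (f := fun x : ℝ≥0∞ => ((x : EReal), -c))
        (continuous_coe_ennreal_ereal.prodMk continuous_const).continuousAt
    have htop : ((⊤ : ℝ≥0∞) : EReal) - c = ⊤ := by
      rw [EReal.coe_ennreal_top]; exact EReal.top_sub hctop
    rw [iInf_subtype', iInf_subtype']
    exact hmono.map_iInf_of_continuousAt hcont.continuousAt htop
  rw [hmap]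
  apply le_antisymm
  · refine le_iInf₂ fun μ hμ => ?_
    have hae := ae_ae_abs_sub_le hJ hμ
    obtain ⟨hprob, K, hK, hKJ, h2⟩ := hμ
    rw [← logEnergy_map_ofReal hR μ hae]
    have hKc : IsCompact (Complex.ofReal '' K) := hK.image Complex.continuous_ofReal
    have hsub : (μ.map Complex.ofReal).support ⊆ Complex.ofReal '' K := by
      refine Measure.support_subset_of_isClosed hKc.isClosed ?_
      rw [mem_ae_iff, Complex.isometry_ofReal.isClosedEmbedding.measurableEmbedding.map_apply, preimage_compl,
        preimage_image_eq _ Complex.ofReal_injective]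
      exact h2
    refine iInf₂_le (μ.map Complex.ofReal) ⟨?_, ?_, ?_⟩
    · exact Measure.isProbabilityMeasure_map Complex.continuous_ofReal.aemeasurable
    · exact hKc.of_isClosed_subset Measure.isClosed_support hsub
    · exact hsub.trans (image_mono hKJ)
  · refine le_iInf₂ fun ν hν => ?_
    obtain ⟨hprob, hcomp, hsub⟩ := hν
    have hsupp : ∀ᵐ z ∂ν, z ∈ ν.support := Measure.support_mem_ae
    have hmem : ν.map Complex.re ∈ compactProbMeasures J := by
      refine ⟨Measure.isProbabilityMeasure_map Complex.continuous_re.aemeasurable,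
        Complex.re '' ν.support, hcomp.image Complex.continuous_re, ?_, ?_⟩
      · rintro _ ⟨z, hz, rfl⟩
        obtain ⟨x, hx, rfl⟩ := hsub hz
        simpa using hx
      · rw [Measure.map_apply Complex.measurable_re
          (hcomp.image Complex.continuous_re).measurableSet.compl]
        refine measure_mono_null ?_ (Measure.measure_compl_support (μ := ν))
        intro z hz hz'
        exact hz ⟨z, hz', rfl⟩
    have hback : (ν.map Complex.re).map Complex.ofReal = ν := by
      rw [Measure.map_map Complex.measurable_ofReal Complex.measurable_re]
      conv_rhs => rw [← Measure.map_id (μ := ν)]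
      refine Measure.map_congr ?_
      filter_upwards [hsupp] with z hz
      obtain ⟨x, hx, rfl⟩ := hsub hz
      simp
    have := hmem.1
    have hE := logEnergy_map_ofReal hR (ν.map Complex.re) (ae_ae_abs_sub_le hJ hmem)
    rw [hback] at hE
    rw [hE]
    exact iInf₂_le _ hmem

/-- Comparison of capacities of subsets of the line through `posLogEnergy`. -/
lemma hasFullCapacity_of_iInf_le {R : ℝ} (hR : 1 ≤ R) {S J : Set ℝ}
    (hJ : ∀ x ∈ J, ∀ y ∈ J, |x - y| ≤ R) (hSJ : S ⊆ J)
    (hle : ⨅ μ ∈ compactProbMeasures S, posLogEnergy R μ ≤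
      ⨅ μ ∈ compactProbMeasures J, posLogEnergy R μ) :
    HasFullCapacity (Complex.ofReal '' S) (Complex.ofReal '' J) := by
  refine ⟨image_mono hSJ, ?_⟩
  unfold logCapacity
  rw [iInf_logEnergy_image_ofReal hR hJ,
    iInf_logEnergy_image_ofReal hR fun x hx y hy => hJ x (hSJ hx) y (hSJ hy)]
  rw [le_antisymm hle (biInf_mono (compactProbMeasures_mono hSJ))]

lemma logCapacity_image_ofReal_pos {R : ℝ} (hR : 1 ≤ R) {J : Set ℝ}
    (hJ : ∀ x ∈ J, ∀ y ∈ J, |x - y| ≤ R)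
    (hfin : ⨅ μ ∈ compactProbMeasures J, posLogEnergy R μ ≠ ⊤) :
    0 < logCapacity (Complex.ofReal '' J) := by
  unfold logCapacity
  rw [iInf_logEnergy_image_ofReal hR hJ]
  lift (⨅ μ ∈ compactProbMeasures J, posLogEnergy R μ) to ℝ≥0 using hfin with v
  rw [pos_iff_ne_zero, Ne, EReal.exp_eq_zero_iff, EReal.neg_eq_bot_iff]
  rw [EReal.coe_ennreal_ofReal]
  exact EReal.coe_ne_top ((v : ℝ) - max (Real.log R) 0)

/-! ### Approximation by measures of bounded density -/

lemma lintegral_posLogKernel_le {R : ℝ} (hR : 0 < R) {D : ℝ≥0∞} {ν : Measure ℝ}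
    (hν : ν ≤ D • volume) (x : ℝ) :
    ∫⁻ y, posLogKernel R (x - y) ∂ν ≤ D * ENNReal.ofReal (2 * R) := by
  calc _ ≤ ∫⁻ y, posLogKernel R (x - y) ∂(D • volume) := lintegral_mono' hν le_rfl
    _ = D * ∫⁻ y, posLogKernel R (x - y) := by rw [lintegral_smul_measure, smul_eq_mul]
    _ = _ := by
      rw [lintegral_sub_left_eq_self (fun t => posLogKernel R t) x, lintegral_posLogKernel hR]

/-- A probability measure of bounded density has finite energy. -/
lemma posLogEnergy_ne_top {R : ℝ} (hR : 0 < R) {D : ℝ≥0∞} (hD : D ≠ ⊤) {ν : Measure ℝ}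
    [IsProbabilityMeasure ν] (hν : ν ≤ D • volume) : posLogEnergy R ν ≠ ⊤ := by
  refine ne_top_of_le_ne_top (b := D * ENNReal.ofReal (2 * R))
    (ENNReal.mul_ne_top hD ENNReal.ofReal_ne_top) ?_
  calc _ ≤ ∫⁻ _, D * ENNReal.ofReal (2 * R) ∂ν :=
        lintegral_mono fun x => lintegral_posLogKernel_le hR hν x
    _ = _ := by simp

/-- The uniform distribution on `[a, b]`. -/
noncomputable def uniformIcc (a b : ℝ) : Measure ℝ :=
  ProbabilityTheory.cond volume (Icc a b)

lemma isProbabilityMeasure_uniformIcc {a b : ℝ} (h : a < b) :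
    IsProbabilityMeasure (uniformIcc a b) :=
  cond_isProbabilityMeasure_of_finite (by simp [h]) (by simp)

lemma uniformIcc_le (a b : ℝ) : uniformIcc a b ≤ (ENNReal.ofReal (b - a))⁻¹ • volume := by
  unfold uniformIcc ProbabilityTheory.cond
  rw [Real.volume_Icc]
  exact smul_le_smul_left _ Measure.restrict_le_self

lemma ae_mem_uniformIcc (a b : ℝ) : ∀ᵐ u ∂(uniformIcc a b), u ∈ Icc a b :=
  ae_cond_mem measurableSet_Icc

lemma volume_preimage_affine {s : ℝ} (hs : 0 < s) (w : ℝ) (A : Set ℝ) :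
    volume ((fun u => w + s * u) ⁻¹' A) = ENNReal.ofReal s⁻¹ * volume A := by
  have : (fun u => w + s * u) ⁻¹' A = (fun u => s * u) ⁻¹' ((fun v => w + v) ⁻¹' A) := rfl
  rw [this, Real.volume_preimage_mul_left hs.ne', measure_preimage_add, abs_of_pos (by positivity)]

lemma map_affine_volume {s : ℝ} (hs : 0 < s) (w : ℝ) :
    volume.map (fun u => w + s * u) = ENNReal.ofReal s⁻¹ • volume := by
  ext A hA
  rw [Measure.map_apply (by fun_prop) hA, volume_preimage_affine hs, Measure.smul_apply, smul_eq_mul]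

/-- The variable `w + s * u` is uniform on an interval of length `r`, hence has density at most `1 /
r`, while the kernel has integral `2 * r`. -/
lemma lintegral_uniformIcc_posLogKernel_le {a b s r : ℝ} (hab : a < b) (hs : 0 < s)
    (hr : r = s * (b - a)) (w : ℝ) :
    ∫⁻ u, posLogKernel r (w + s * u) ∂(uniformIcc a b) ≤ 2 := by
  have hr0 : 0 < r := by rw [hr]; exact mul_pos hs (sub_pos.2 hab)
  calc _ ≤ ∫⁻ u, posLogKernel r (w + s * u) ∂((ENNReal.ofReal (b - a))⁻¹ • volume) :=
        lintegral_mono' (uniformIcc_le a b) le_rfl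
    _ = (ENNReal.ofReal (b - a))⁻¹ * ∫⁻ v, posLogKernel r v ∂(volume.map (fun u => w + s * u)) := by
        rw [lintegral_smul_measure, smul_eq_mul, lintegral_map (by fun_prop) (by fun_prop)]
    _ = (ENNReal.ofReal (b - a))⁻¹ * (ENNReal.ofReal s⁻¹ * ENNReal.ofReal (2 * r)) := by
        rw [map_affine_volume hs, lintegral_smul_measure, smul_eq_mul, lintegral_posLogKernel hr0]
    _ = 2 := by
        have hba := sub_pos.2 hab
        rw [← ENNReal.ofReal_inv_of_pos hba, ← ENNReal.ofReal_mul (by positivity),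
          ← ENNReal.ofReal_mul (by positivity), hr]
        rw [show (b - a)⁻¹ * (s⁻¹ * (2 * (s * (b - a)))) = 2 by field_simp]
        simp
    _ ≤ 2 := le_rfl

/-- The kernel averaged over the increments of a uniform distribution. -/
noncomputable def smoothedKernel (R a b s d : ℝ) : ℝ≥0∞ :=
  ∫⁻ u, ∫⁻ u', posLogKernel R ((1 - s) * d + s * (u - u')) ∂(uniformIcc a b) ∂(uniformIcc a b)

lemma ofReal_log_le_posLogKernel_add {R q r d : ℝ} (hR : 0 < R) (hr : 0 < r) (hq : 0 < q)
    (h : |d| ≤ q * r) :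
    ENNReal.ofReal (Real.log (R / r)) ≤ posLogKernel R d + ENNReal.ofReal (Real.log q) := by
  rcases eq_or_ne d 0 with rfl | hd
  · simp
  have hd' := abs_pos.2 hd
  rw [posLogKernel_of_ne hd]
  refine le_trans (ENNReal.ofReal_le_ofReal ?_) ENNReal.ofReal_add_le
  rw [← Real.log_mul (by positivity) (by positivity)]
  refine Real.log_le_log (by positivity) ?_
  rw [div_mul_eq_mul_div, div_le_div_iff₀ hr hd']
  nlinarith

/-- A bound uniform in `s`, to serve as the majorant in the reverse Fatou lemma. Put `r = s * (b -
a)`. If `|d| ≥ 4 * r`, the perturbation is at most `r` and `(1 - s) * |d| ≥ |d| / 2`, so the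
argument keeps size `|d| / 4`. Otherwise averaging over `u` alone costs at most `log⁺ (R / r) + 2`,
and `R / r ≤ 4 * R / |d|`. -/
lemma smoothedKernel_le {R a b s : ℝ} (hR : 0 < R) (hab : a < b) (hs : 0 < s) (hs2 : s ≤ 1 / 2)
    (d : ℝ) :
    smoothedKernel R a b s d ≤ posLogKernel R d + ENNReal.ofReal (Real.log 4) + 2 := by
  have := isProbabilityMeasure_uniformIcc hab
  have hL := sub_pos.2 hab
  have hr : 0 < s * (b - a) := mul_pos hs hL
  have hconst : ∀ c : ℝ≥0∞, ∫⁻ _, ∫⁻ _, c ∂(uniformIcc a b) ∂(uniformIcc a b) = c := by simp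
  unfold smoothedKernel
  rcases le_or_gt (4 * (s * (b - a))) |d| with h | h
  · rw [← hconst (posLogKernel R d + ENNReal.ofReal (Real.log 4) + 2)]
    refine lintegral_mono_ae ?_
    filter_upwards [ae_mem_uniformIcc a b] with u hu
    refine lintegral_mono_ae ?_
    filter_upwards [ae_mem_uniformIcc a b] with u' hu'
    refine le_trans ?_ le_self_add
    have hd : 0 < |d| := by linarith
    have h1 : |d| / 4 ≤ |(1 - s) * d + s * (u - u')| := by
      have h2 : |s * (u - u')| ≤ s * (b - a) := by
        rw [abs_mul, abs_of_pos hs]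
        exact mul_le_mul_of_nonneg_left (abs_le.2 ⟨by linarith [hu.1, hu'.2],
          by linarith [hu.2, hu'.1]⟩) hs.le
      have h3 : |(1 - s) * d| ≤ |(1 - s) * d + s * (u - u')| + |s * (u - u')| := by
        have := abs_sub ((1 - s) * d + s * (u - u')) (s * (u - u'))
        simpa using this
      rw [abs_mul, abs_of_pos (by linarith : 0 < 1 - s)] at h3
      nlinarith
    calc _ ≤ posLogKernel R (|d| / 4) :=
          posLogKernel_le_of_abs_le hR (by rwa [abs_of_pos (by positivity)])
      _ = ENNReal.ofReal (Real.log (R / (|d| / 4))) := by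
          rw [posLogKernel_of_ne (by positivity), abs_of_pos (by positivity)]
      _ ≤ _ := ofReal_log_le_posLogKernel_add hR (by positivity) (by norm_num) (by linarith)
  · rw [lintegral_lintegral_swap (by fun_prop)]
    calc _ ≤ ∫⁻ u', (posLogKernel R d + ENNReal.ofReal (Real.log 4) + 2) ∂(uniformIcc a b) := by
          refine lintegral_mono fun u' => ?_
          calc _ ≤ ∫⁻ u, (ENNReal.ofReal (Real.log (R / (s * (b - a)))) +
                posLogKernel (s * (b - a)) (((1 - s) * d - s * u') + s * u)) ∂(uniformIcc a b) := by
                refine lintegral_mono fun u => ?_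
                rw [show (1 - s) * d + s * (u - u') = ((1 - s) * d - s * u') + s * u by ring]
                exact posLogKernel_add_le hr hR
            _ ≤ ENNReal.ofReal (Real.log (R / (s * (b - a)))) + 2 := by
                rw [lintegral_add_left measurable_const, lintegral_const, measure_univ, mul_one]
                gcongr
                exact lintegral_uniformIcc_posLogKernel_le hab hs rfl _
            _ ≤ _ := by
                gcongr
                exact ofReal_log_le_posLogKernel_add hR hr (by norm_num) h.le
      _ = _ := by simp

lemma limsup_smoothedKernel_le {R a b : ℝ} (hR : 0 < R) (hab : a < b) {s : ℕ → ℝ}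
    (hs : Tendsto s atTop (𝓝 0)) (hs0 : ∀ n, 0 < s n) (hs1 : ∀ n, s n ≤ 1 / 2) {d : ℝ} (hd : d ≠ 0) :
    limsup (fun n => smoothedKernel R a b (s n) d) atTop ≤ posLogKernel R d := by
  have := isProbabilityMeasure_uniformIcc hab
  have hd' := abs_pos.2 hd
  set m : ℕ → ℝ := fun n => |d| - s n * (|d| + (b - a)) with hm
  have hmt : Tendsto m atTop (𝓝 |d|) := by
    have := (tendsto_const_nhds (x := |d|)).sub (hs.mul_const (|d| + (b - a)))
    simpa using this
  have hlim : Tendsto (fun n => ENNReal.ofReal (Real.log (R / m n))) atTop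
      (𝓝 (posLogKernel R d)) := by
    rw [posLogKernel_of_ne hd]
    refine ENNReal.tendsto_ofReal (Tendsto.log ?_ (by positivity))
    exact tendsto_const_nhds.div hmt hd'.ne'
  rw [← hlim.limsup_eq]
  refine limsup_le_limsup ?_
  filter_upwards [hmt.eventually_const_lt hd'] with n hn
  calc smoothedKernel R a b (s n) d ≤
      ∫⁻ _, ∫⁻ _, ENNReal.ofReal (Real.log (R / m n)) ∂(uniformIcc a b) ∂(uniformIcc a b) := by
        refine lintegral_mono_ae ?_
        filter_upwards [ae_mem_uniformIcc a b] with u hu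
        refine lintegral_mono_ae ?_
        filter_upwards [ae_mem_uniformIcc a b] with u' hu'
        have h1 : m n ≤ |(1 - s n) * d + s n * (u - u')| := by
          have h2 : |s n * (u - u')| ≤ s n * (b - a) := by
            rw [abs_mul, abs_of_pos (hs0 n)]
            exact mul_le_mul_of_nonneg_left (abs_le.2 ⟨by linarith [hu.1, hu'.2],
              by linarith [hu.2, hu'.1]⟩) (hs0 n).le
          have h3 : |(1 - s n) * d| ≤ |(1 - s n) * d + s n * (u - u')| + |s n * (u - u')| := by
            have := abs_sub ((1 - s n) * d + s n * (u - u')) (s n * (u - u'))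
            simpa using this
          rw [abs_mul, abs_of_pos (by linarith [hs1 n] : 0 < 1 - s n)] at h3
          simp only [hm]
          linarith
        calc _ ≤ posLogKernel R (m n) := posLogKernel_le_of_abs_le hR (by rwa [abs_of_pos hn])
          _ = _ := by rw [posLogKernel_of_ne hn.ne', abs_of_pos hn]
    _ = _ := by simp

/-- The law of `(1 - s) X + s U`, where `X` has law `μ` and `U` is uniform on `[a, b]`. -/
noncomputable def smoothedMeasure (μ : Measure ℝ) (a b s : ℝ) : Measure ℝ :=
  (μ.prod (uniformIcc a b)).map fun p => (1 - s) * p.1 + s * p.2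

lemma isProbabilityMeasure_smoothedMeasure {μ : Measure ℝ} [IsProbabilityMeasure μ] {a b : ℝ}
    (hab : a < b) (s : ℝ) : IsProbabilityMeasure (smoothedMeasure μ a b s) := by
  have := isProbabilityMeasure_uniformIcc hab
  exact Measure.isProbabilityMeasure_map (by fun_prop)

lemma smoothedMeasure_le {μ : Measure ℝ} [IsProbabilityMeasure μ] {a b s : ℝ} (hab : a < b)
    (hs : 0 < s) :
    smoothedMeasure μ a b s ≤ ((ENNReal.ofReal (b - a))⁻¹ * ENNReal.ofReal s⁻¹) • volume := by
  have := isProbabilityMeasure_uniformIcc hab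
  refine Measure.le_intro fun A hA _ => ?_
  unfold smoothedMeasure
  have hmeas : Measurable fun p : ℝ × ℝ => (1 - s) * p.1 + s * p.2 := by fun_prop
  rw [Measure.map_apply hmeas hA, Measure.prod_apply (hmeas hA)]
  calc _ ≤ ∫⁻ _, (ENNReal.ofReal (b - a))⁻¹ * ENNReal.ofReal s⁻¹ * volume A ∂μ := by
        refine lintegral_mono fun x => ?_
        refine (uniformIcc_le a b _).trans ?_
        rw [Measure.smul_apply, smul_eq_mul, mul_assoc]
        gcongr
        exact (volume_preimage_affine hs ((1 - s) * x) A).le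
    _ = _ := by simp

lemma posLogEnergy_smoothedMeasure (R : ℝ) {μ : Measure ℝ} [IsProbabilityMeasure μ] {a b : ℝ}
    (hab : a < b) (s : ℝ) :
    posLogEnergy R (smoothedMeasure μ a b s) =
      ∫⁻ p, smoothedKernel R a b s (p.1 - p.2) ∂(μ.prod μ) := by
  have := isProbabilityMeasure_uniformIcc hab
  unfold posLogEnergy smoothedMeasure
  have hmeas : Measurable fun p : ℝ × ℝ => (1 - s) * p.1 + s * p.2 := by fun_prop
  rw [lintegral_map (Measurable.lintegral_prod_right' (f := fun p : ℝ × ℝ =>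
    posLogKernel R (p.1 - p.2)) (by fun_prop)) hmeas]
  have h1 : ∀ x : ℝ, ∫⁻ y, posLogKernel R (x - y)
      ∂((μ.prod (uniformIcc a b)).map fun p => (1 - s) * p.1 + s * p.2) =
      ∫⁻ x', ∫⁻ u', posLogKernel R (x - ((1 - s) * x' + s * u')) ∂(uniformIcc a b) ∂μ := by
    intro x
    rw [lintegral_map (by fun_prop) hmeas, lintegral_prod _ (by fun_prop)]
  simp only [h1]
  have hm4 : Measurable fun q : (ℝ × ℝ) × ℝ => ∫⁻ u', posLogKernel R
      ((1 - s) * q.1.1 + s * q.1.2 - ((1 - s) * q.2 + s * u')) ∂(uniformIcc a b) :=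
    Measurable.lintegral_prod_right' (f := fun q : ((ℝ × ℝ) × ℝ) × ℝ => posLogKernel R
      ((1 - s) * q.1.1.1 + s * q.1.1.2 - ((1 - s) * q.1.2 + s * q.2))) (by fun_prop)
  have hm5 : Measurable fun q : ℝ × ℝ => smoothedKernel R a b s (q.1 - q.2) := by
    unfold smoothedKernel
    refine Measurable.lintegral_prod_right' (f := fun q : (ℝ × ℝ) × ℝ => ∫⁻ u', posLogKernel R
      ((1 - s) * (q.1.1 - q.1.2) + s * (q.2 - u')) ∂(uniformIcc a b)) ?_
    exact Measurable.lintegral_prod_right' (f := fun q : ((ℝ × ℝ) × ℝ) × ℝ => posLogKernel R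
      ((1 - s) * (q.1.1.1 - q.1.1.2) + s * (q.1.2 - q.2))) (by fun_prop)
  rw [lintegral_prod _ hm4.lintegral_prod_right'.aemeasurable, lintegral_prod _ hm5.aemeasurable]
  refine lintegral_congr fun x => ?_
  rw [lintegral_lintegral_swap]
  · refine lintegral_congr fun x' => ?_
    unfold smoothedKernel
    refine lintegral_congr fun u => lintegral_congr fun u' => ?_
    congr 1
    ring
  · exact (hm4.comp (f := fun q : ℝ × ℝ => ((x, q.1), q.2)) (by fun_prop)).aemeasurable

lemma measurable_smoothedKernel {R a b : ℝ} (hab : a < b) (s : ℝ) :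
    Measurable (smoothedKernel R a b s) := by
  have := isProbabilityMeasure_uniformIcc hab
  unfold smoothedKernel
  refine Measurable.lintegral_prod_right' (f := fun q : ℝ × ℝ => ∫⁻ u', posLogKernel R
      ((1 - s) * q.1 + s * (q.2 - u')) ∂(uniformIcc a b)) ?_
  exact Measurable.lintegral_prod_right' (f := fun q : (ℝ × ℝ) × ℝ => posLogKernel R
      ((1 - s) * q.1.1 + s * (q.1.2 - q.2))) (by fun_prop)

/-- A measure of finite energy is approximated in energy by measures of bounded density. -/
lemma exists_bounded_density_posLogEnergy_lt {R : ℝ} (hR : 0 < R) {J : Set ℝ} (hJ : J.OrdConnected)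
    (hJn : J.Nontrivial) {μ : Measure ℝ} (hμ : μ ∈ compactProbMeasures J) {c : ℝ≥0∞}
    (hc : posLogEnergy R μ < c) :
    ∃ ν ∈ compactProbMeasures J, ∃ D : ℝ≥0∞, D ≠ ⊤ ∧ ν ≤ D • volume ∧ posLogEnergy R ν < c := by
  obtain ⟨hprob, K, hK, hKJ, h0⟩ := hμ
  obtain ⟨a, ha, b, hb, hab⟩ := hJn.exists_lt
  have hUp := isProbabilityMeasure_uniformIcc hab
  set s : ℕ → ℝ := fun n => 1 / ((n : ℝ) + 2) with hsdef
  have hs : Tendsto s atTop (𝓝 0) := by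
    have h1 : Tendsto (fun n : ℕ => (n : ℝ) + 2) atTop atTop :=
      tendsto_atTop_add_const_right _ _ tendsto_natCast_atTop_atTop
    refine h1.inv_tendsto_atTop.congr fun n => ?_
    simp [hsdef]
  have hs0 : ∀ n, 0 < s n := fun n => by positivity
  have hs1 : ∀ n, s n ≤ 1 / 2 := fun n => by
    simp only [hsdef]
    gcongr
    linarith [n.cast_nonneg (α := ℝ)]
  have hEt : posLogEnergy R μ ≠ ⊤ := (hc.trans_le le_top).ne
  have hlim : limsup (fun n => posLogEnergy R (smoothedMeasure μ a b (s n))) atTop ≤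
      posLogEnergy R μ := by
    simp only [posLogEnergy_smoothedMeasure R hab]
    refine (limsup_lintegral_le
      (fun p : ℝ × ℝ => posLogKernel R (p.1 - p.2) + (ENNReal.ofReal (Real.log 4) + 2)) ?_ ?_ ?_).trans ?_
    · intro n
      exact (measurable_smoothedKernel hab _).comp (by fun_prop)
    · intro n
      refine Eventually.of_forall fun p => ?_
      simpa [add_assoc] using smoothedKernel_le hR hab (hs0 n) (hs1 n) (p.1 - p.2)
    · rw [lintegral_add_right _ measurable_const, ← posLogEnergy_eq_lintegral_prod]
      simp [hEt]
    · rw [posLogEnergy_eq_lintegral_prod]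
      rw [posLogEnergy_eq_lintegral_prod] at hEt
      refine lintegral_mono_ae ?_
      -- Finite energy makes the diagonal, where the pointwise limsup bound is not available, a null
      -- set.
      filter_upwards [ae_lt_top (by fun_prop) hEt] with p hp
      refine limsup_smoothedKernel_le hR hab hs hs0 hs1 ?_
      intro h
      simp [h] at hp
  obtain ⟨n, hn⟩ := (eventually_lt_of_limsup_lt (hlim.trans_lt hc)).exists
  refine ⟨smoothedMeasure μ a b (s n), ⟨isProbabilityMeasure_smoothedMeasure hab _,
    (fun p : ℝ × ℝ => (1 - s n) * p.1 + s n * p.2) '' (K ×ˢ Icc a b), ?_, ?_, ?_⟩, _, ?_,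
    smoothedMeasure_le hab (hs0 n), hn⟩
  · exact (hK.prod isCompact_Icc).image (by fun_prop)
  · rintro _ ⟨p, ⟨hp1, hp2⟩, rfl⟩
    have := hJ.convex (hKJ hp1) (hJ.out ha hb hp2) (by linarith [hs1 n] : 0 ≤ 1 - s n) (hs0 n).le
      (by ring)
    simpa using this
  · have hmeas : Measurable fun p : ℝ × ℝ => (1 - s n) * p.1 + s n * p.2 := by fun_prop
    unfold smoothedMeasure
    rw [Measure.map_apply hmeas
      ((hK.prod isCompact_Icc).image (by fun_prop)).measurableSet.compl]
    have h1 : ∀ᵐ p ∂(μ.prod (uniformIcc a b)), p ∈ K ×ˢ Icc a b := by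
      have h2 : ∀ᵐ x ∂μ, x ∈ K := h0
      filter_upwards [Measure.quasiMeasurePreserving_fst.ae h2,
        Measure.quasiMeasurePreserving_snd.ae (ae_mem_uniformIcc a b)] with p hp1 hp2
      exact ⟨hp1, hp2⟩
    refine measure_mono_null ?_ h1
    intro p hp hp'
    exact hp ⟨p, hp', rfl⟩
  · refine ENNReal.mul_ne_top (ENNReal.inv_ne_top.2 ?_) ENNReal.ofReal_ne_top
    simpa using hab

/-! ### Points of positive lower density of the law -/

lemma measurable_measure_closedBall (ρ : Measure ℝ) [SFinite ρ] (r : ℝ) :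
    Measurable fun x => ρ (Metric.closedBall x r) := by
  have h : MeasurableSet {p : ℝ × ℝ | dist p.2 p.1 ≤ r} :=
    measurableSet_le (by fun_prop) measurable_const
  exact measurable_measure_prodMk_left h

/-- The points at which `ρ` has lower density at least `1 / (n + 1)` along the radii `l k / 4`,
`k ≥ n`. -/
def lowerDensitySet (ρ : Measure ℝ) (l : ℕ → ℝ) (n : ℕ) : Set ℝ :=
  {x | ∀ k ≥ n, ENNReal.ofReal (l k / (n + 1)) ≤ ρ (Metric.closedBall x (l k / 4))}

lemma measurableSet_lowerDensitySet (ρ : Measure ℝ) [SFinite ρ] (l : ℕ → ℝ) (n : ℕ) :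
    MeasurableSet (lowerDensitySet ρ l n) := by
  have : lowerDensitySet ρ l n =
      ⋂ k ≥ n, {x | ENNReal.ofReal (l k / (n + 1)) ≤ ρ (Metric.closedBall x (l k / 4))} := by
    ext x
    simp [lowerDensitySet]
  rw [this]
  exact MeasurableSet.iInter fun k => MeasurableSet.iInter fun _ =>
    measurableSet_le measurable_const (measurable_measure_closedBall ρ _)

lemma monotone_lowerDensitySet (ρ : Measure ℝ) {l : ℕ → ℝ} (hl : ∀ k, 0 < l k) :
    Monotone (lowerDensitySet ρ l) := by
  intro m n hmn x hx k hk
  refine le_trans ?_ (hx k (hmn.trans hk))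
  have := (hl k).le
  gcongr

lemma ae_exists_mem_lowerDensitySet {ρ : Measure ℝ} [IsFiniteMeasure ρ] (hρ : ρ ≪ volume)
    {l : ℕ → ℝ} (hl : ∀ k, 0 < l k) (hl0 : Tendsto l atTop (𝓝 0)) :
    ∀ᵐ x ∂ρ, ∃ n, x ∈ lowerDensitySet ρ l n := by
  filter_upwards [hρ.ae_le (Besicovitch.ae_tendsto_rnDeriv ρ volume), Measure.rnDeriv_pos hρ]
    with x hx hpos
  obtain ⟨b, hb0, hb⟩ := ENNReal.lt_iff_exists_nnreal_btwn.1 hpos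
  have hb0' : (0 : ℝ) < b := by exact_mod_cast hb0
  have hr : Tendsto (fun k => l k / 4) atTop (𝓝[>] 0) := by
    refine tendsto_nhdsWithin_iff.2 ⟨by simpa using hl0.div_const 4, Eventually.of_forall fun k => ?_⟩
    have := hl k
    simp only [mem_Ioi]
    positivity
  obtain ⟨k₀, hk₀⟩ := eventually_atTop.1 ((hx.comp hr).eventually_const_lt hb)
  -- The ball of radius `l k / 4` has length `l k / 2`, so an average density above `b` gives it
  -- mass above `b / 2 * l k`.
  obtain ⟨n₀, hn₀⟩ := exists_nat_one_div_lt (show (0 : ℝ) < b / 2 by positivity)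
  refine ⟨max k₀ n₀, fun k hk => ?_⟩
  have h1 := hk₀ k ((le_max_left _ _).trans hk)
  have hlk := hl k
  simp only [Function.comp_apply] at h1
  rw [Real.volume_closedBall, ENNReal.lt_div_iff_mul_lt (Or.inl (by simp [hlk]))
    (Or.inl ENNReal.ofReal_ne_top)] at h1
  refine le_trans ?_ h1.le
  rw [← ENNReal.ofReal_coe_nnreal, ← ENNReal.ofReal_mul (by positivity)]
  refine ENNReal.ofReal_le_ofReal ?_
  have h2 : 1 / (((max k₀ n₀ : ℕ) : ℝ) + 1) ≤ 1 / ((n₀ : ℝ) + 1) := by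
    gcongr
    exact le_max_right _ _
  calc l k / (((max k₀ n₀ : ℕ) : ℝ) + 1) = l k * (1 / (((max k₀ n₀ : ℕ) : ℝ) + 1)) := by ring
    _ ≤ l k * (b / 2) := mul_le_mul_of_nonneg_left (h2.trans hn₀.le) hlk.le
    _ = b * (2 * (l k / 4)) := by ring

lemma posLogEnergy_mono (R : ℝ) {μ ν : Measure ℝ} (h : μ ≤ ν) :
    posLogEnergy R μ ≤ posLogEnergy R ν :=
  lintegral_mono' h fun _ => lintegral_mono' h le_rfl

lemma posLogEnergy_smul (R : ℝ) (c : ℝ≥0∞) (μ : Measure ℝ) [SFinite μ] :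
    posLogEnergy R (c • μ) = c * c * posLogEnergy R μ := by
  unfold posLogEnergy
  simp only [lintegral_smul_measure, smul_eq_mul]
  rw [lintegral_const_mul, mul_assoc]
  exact Measurable.lintegral_prod_right' (f := fun p : ℝ × ℝ => posLogKernel R (p.1 - p.2))
    (by fun_prop)

/-- Approximation in energy by measures of bounded density that are concentrated on a set where
`ρ` has uniformly positive lower density. -/
lemma exists_lowerDensitySet_posLogEnergy_lt {R : ℝ} {J : Set ℝ} {ν ρ : Measure ℝ}
    [IsFiniteMeasure ρ] (hρ : ρ ≪ volume) (hνρ : ν ≪ ρ) (hν : ν ∈ compactProbMeasures J)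
    {D : ℝ≥0∞} (hD : D ≠ ⊤) (hνD : ν ≤ D • volume)
    {l : ℕ → ℝ} (hl : ∀ k, 0 < l k) (hl0 : Tendsto l atTop (𝓝 0))
    {c : ℝ≥0∞} (hc : posLogEnergy R ν < c) :
    ∃ ν' ∈ compactProbMeasures J, ∃ D' : ℝ≥0∞, D' ≠ ⊤ ∧ ν' ≤ D' • volume ∧
      (∃ n, ∀ᵐ x ∂ν', x ∈ lowerDensitySet ρ l n) ∧ posLogEnergy R ν' < c := by
  obtain ⟨hprob, K, hK, hKJ, h0⟩ := hν
  have hmeas := measurableSet_lowerDensitySet ρ l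
  have hunion : ν (⋃ n, lowerDensitySet ρ l n) = 1 := by
    rw [prob_compl_eq_zero_iff (MeasurableSet.iUnion hmeas) |>.symm]
    have := hνρ.ae_le (ae_exists_mem_lowerDensitySet hρ hl hl0)
    rw [← mem_ae_iff]
    filter_upwards [this] with x hx
    exact mem_iUnion.2 hx
  have htend : Tendsto (fun n => ν (lowerDensitySet ρ l n)) atTop (𝓝 1) := by
    rw [← hunion]
    exact tendsto_measure_iUnion_atTop (monotone_lowerDensitySet ρ hl)
  -- Conditioning multiplies the energy by at most the inverse square of the mass retained, which
  -- tends to 1.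
  have htend2 : Tendsto (fun n => (ν (lowerDensitySet ρ l n))⁻¹ * (ν (lowerDensitySet ρ l n))⁻¹ *
      posLogEnergy R ν) atTop (𝓝 (posLogEnergy R ν)) := by
    have h1 : Tendsto (fun n => (ν (lowerDensitySet ρ l n))⁻¹) atTop (𝓝 1) := by
      simpa using tendsto_inv_iff.2 htend
    have h2 := ENNReal.Tendsto.mul h1 (by simp) h1 (by simp)
    have h3 := ENNReal.Tendsto.mul_const (b := posLogEnergy R ν) h2 (by simp)
    simpa using h3
  obtain ⟨n, hn1, hn2⟩ := ((htend2.eventually_lt_const hc).and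
    (htend.eventually_const_lt (show (0 : ℝ≥0∞) < 1 by simp))).exists
  refine ⟨ProbabilityTheory.cond ν (lowerDensitySet ρ l n), ⟨cond_isProbabilityMeasure hn2.ne', K, hK,
    hKJ, cond_absolutelyContinuous h0⟩, (ν (lowerDensitySet ρ l n))⁻¹ * D,
    ENNReal.mul_ne_top (ENNReal.inv_ne_top.2 hn2.ne') hD, ?_, ⟨n, ae_cond_mem (hmeas n)⟩, ?_⟩
  · unfold ProbabilityTheory.cond
    rw [mul_smul]
    exact smul_le_smul_left _ (Measure.restrict_le_self.trans hνD)
  · unfold ProbabilityTheory.cond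
    rw [posLogEnergy_smul]
    refine lt_of_le_of_lt ?_ hn1
    gcongr
    exact posLogEnergy_mono R Measure.restrict_le_self

/-! ### Normalised indicators and harmonic weights -/

/-- The indicator of `|y - x| ≤ l k / 4`, normalised to have mean one when `y` has law `ρ`. -/
noncomputable def hit (ρ : Measure ℝ) (l : ℕ → ℝ) (k : ℕ) (y x : ℝ) : ℝ≥0∞ :=
  (Metric.closedBall x (l k / 4)).indicator 1 y * (ρ (Metric.closedBall x (l k / 4)))⁻¹

lemma measurable_hit (ρ : Measure ℝ) [SFinite ρ] (l : ℕ → ℝ) (k : ℕ) :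
    Measurable fun p : ℝ × ℝ => hit ρ l k p.1 p.2 := by
  unfold hit
  refine Measurable.mul ?_ (((measurable_measure_closedBall ρ _).comp measurable_snd).inv)
  have h : MeasurableSet {p : ℝ × ℝ | dist p.1 p.2 ≤ l k / 4} :=
    measurableSet_le (by fun_prop) measurable_const
  exact (measurable_one (α := ℝ≥0∞)).indicator h

lemma measurable_hit_left (ρ : Measure ℝ) [SFinite ρ] (l : ℕ → ℝ) (k : ℕ) (x : ℝ) :
    Measurable fun y => hit ρ l k y x :=
  (measurable_hit ρ l k).comp (measurable_id.prodMk measurable_const)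

lemma lintegral_hit {ρ : Measure ℝ} [IsFiniteMeasure ρ] {l : ℕ → ℝ} {n k : ℕ}
    (hl : ∀ k, 0 < l k) {x : ℝ}
    (hx : x ∈ lowerDensitySet ρ l n) (hk : n ≤ k) : ∫⁻ y, hit ρ l k y x ∂ρ = 1 := by
  unfold hit
  have h0 : ρ (Metric.closedBall x (l k / 4)) ≠ 0 := by
    refine (lt_of_lt_of_le ?_ (hx k hk)).ne'
    have := hl k
    rw [ENNReal.ofReal_pos]
    positivity
  rw [lintegral_mul_const _ (measurable_one.indicator Metric.isClosed_closedBall.measurableSet),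
    lintegral_indicator_one Metric.isClosed_closedBall.measurableSet,
    ENNReal.mul_inv_cancel h0 (measure_ne_top _ _)]

/-- Both factors are nonzero only if `x` and `y` lie within `l k / 4` of `z`, which forces `|x - y|
≤ l k / 2`. One factor is then bounded through the lower density, and the other integrates to one.
-/
lemma lintegral_hit_mul_hit_le {ρ : Measure ℝ} [IsFiniteMeasure ρ] {l : ℕ → ℝ} {n k : ℕ}
    (hl : ∀ k, 0 < l k) {x y : ℝ} (hx : x ∈ lowerDensitySet ρ l n) (hy : y ∈ lowerDensitySet ρ l n)
    (hk : n ≤ k) :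
    ∫⁻ z, hit ρ l k z x * hit ρ l k z y ∂ρ ≤
      (ENNReal.ofReal (l k / (n + 1)))⁻¹ * {t : ℝ | |t| ≤ l k / 2}.indicator 1 (x - y) := by
  calc _ ≤ ∫⁻ z, hit ρ l k z x * ((ENNReal.ofReal (l k / (n + 1)))⁻¹ *
        {t : ℝ | |t| ≤ l k / 2}.indicator 1 (x - y)) ∂ρ := by
        refine lintegral_mono fun z => ?_
        by_cases h1 : z ∈ Metric.closedBall x (l k / 4)
        · by_cases h2 : z ∈ Metric.closedBall y (l k / 4)
          · have h3 : x - y ∈ {t : ℝ | |t| ≤ l k / 2} := by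
              rw [Metric.mem_closedBall, Real.dist_eq] at h1 h2
              have h1' := abs_le.1 h1
              have h2' := abs_le.1 h2
              have h4 : |x - y| ≤ l k / 2 := abs_le.2 ⟨by linarith, by linarith⟩
              exact h4
            rw [indicator_of_mem h3]
            simp only [Pi.one_apply, mul_one]
            gcongr
            unfold hit
            rw [indicator_of_mem h2]
            simp only [Pi.one_apply, one_mul]
            exact ENNReal.inv_le_inv.2 (hy k hk)
          · simp [hit, indicator_of_notMem h2]
        · simp [hit, indicator_of_notMem h1]
    _ = _ := by
        rw [lintegral_mul_const _ (measurable_hit_left ρ l k x), lintegral_hit hl hx hk, one_mul]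

/-- Partial harmonic sum over `Ico n N`. -/
noncomputable def blockSum (n N : ℕ) : ℝ≥0∞ := ∑ k ∈ Finset.Ico n N, (k : ℝ≥0∞)⁻¹

/-- Harmonic probability weights on `Ico n N`. -/
noncomputable def blockWeight (n N k : ℕ) : ℝ≥0∞ := (k : ℝ≥0∞)⁻¹ * (blockSum n N)⁻¹

lemma blockSum_ne_top {n N : ℕ} (hn : 1 ≤ n) : blockSum n N ≠ ⊤ := by
  unfold blockSum
  refine ENNReal.sum_ne_top.2 fun k hk => ?_
  rw [ENNReal.inv_ne_top]
  have := (Finset.mem_Ico.1 hk).1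
  exact_mod_cast (by omega : k ≠ 0)

lemma blockSum_ne_zero {n N : ℕ} (hN : n < N) : blockSum n N ≠ 0 := by
  unfold blockSum
  intro h
  have := Finset.sum_eq_zero_iff.1 h n (Finset.mem_Ico.2 ⟨le_rfl, hN⟩)
  exact ENNReal.inv_ne_zero.2 (ENNReal.natCast_ne_top n) this

lemma sum_blockWeight {n N : ℕ} (hn : 1 ≤ n) (hN : n < N) :
    ∑ k ∈ Finset.Ico n N, blockWeight n N k = 1 := by
  unfold blockWeight
  rw [← Finset.sum_mul]
  exact ENNReal.mul_inv_cancel (blockSum_ne_zero hN) (blockSum_ne_top hn)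

/-- The factor `k` stands for the size of the kernel at scale `l k`. By Cauchy–Schwarz, weights
proportional to `1 / k` minimise this sum among weights of total one. -/
lemma sum_sq_blockWeight_mul {n N : ℕ} (hn : 1 ≤ n) (hN : n < N) :
    ∑ k ∈ Finset.Ico n N, blockWeight n N k * blockWeight n N k * k = (blockSum n N)⁻¹ := by
  have : ∀ k ∈ Finset.Ico n N, blockWeight n N k * blockWeight n N k * k =
      blockWeight n N k * (blockSum n N)⁻¹ := by
    intro k hk
    have hk0 : k ≠ 0 := by have := (Finset.mem_Ico.1 hk).1; omega
    have h1 : (k : ℝ≥0∞)⁻¹ * k = 1 :=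
      ENNReal.inv_mul_cancel (by exact_mod_cast hk0) (ENNReal.natCast_ne_top k)
    calc _ = blockWeight n N k * (blockSum n N)⁻¹ * ((k : ℝ≥0∞)⁻¹ * k) := by
          rw [mul_assoc, mul_assoc]
          congr 1
          unfold blockWeight
          ring
      _ = _ := by rw [h1, mul_one]
  rw [Finset.sum_congr rfl this, ← Finset.sum_mul, sum_blockWeight hn hN, one_mul]

lemma tendsto_blockSum (n : ℕ) : Tendsto (blockSum n) atTop (𝓝 ⊤) := by
  have h1 : ∑' k : ℕ, (((k + n : ℕ) : ℝ≥0∞))⁻¹ = ⊤ := by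
    by_contra h
    -- The extra shift by one avoids the term `k + n = 0`, whose inverse is `⊤` in `ℝ≥0∞` but 0 in
    -- `ℝ≥0`.
    have h2 : Summable fun k : ℕ => ((((k + n + 1 : ℕ) : ℝ≥0)⁻¹)) := by
      rw [← ENNReal.tsum_coe_ne_top_iff_summable]
      refine ne_top_of_le_ne_top h (ENNReal.tsum_le_tsum fun k => ?_)
      rw [ENNReal.coe_inv (by positivity)]
      refine ENNReal.inv_le_inv.2 ?_
      push_cast
      exact le_self_add
    have h3 : Summable fun k : ℕ => (((k + (n + 1) : ℕ) : ℝ))⁻¹ := by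
      have := NNReal.summable_coe.2 h2
      refine this.congr fun k => ?_
      push_cast
      ring_nf
    exact Real.not_summable_natCast_inv ((summable_nat_add_iff (n + 1)).1 h3)
  have h2 := ENNReal.tendsto_nat_tsum fun k : ℕ => (((k + n : ℕ) : ℝ≥0∞))⁻¹
  rw [h1] at h2
  have h3 := h2.comp (tendsto_sub_atTop_nat n)
  refine h3.congr fun N => ?_
  simp only [Function.comp_apply, blockSum]
  rw [Finset.sum_Ico_eq_sum_range]
  exact Finset.sum_congr rfl fun k _ => by rw [add_comm]

/-- A convex combination of the functions `hit k`, `k ∈ Ico n N`. -/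
noncomputable def blockDensity (ρ : Measure ℝ) (l : ℕ → ℝ) (n N : ℕ) (y : ℕ → ℝ) (x : ℝ) : ℝ≥0∞ :=
  ∑ k ∈ Finset.Ico n N, blockWeight n N k * hit ρ l k (y k) x

/-- The bound for the excess of the two-point correlation of `blockDensity` over one. -/
noncomputable def blockExcess (l : ℕ → ℝ) (m n N : ℕ) (t : ℝ) : ℝ≥0∞ :=
  ∑ k ∈ Finset.Ico n N, blockWeight n N k * blockWeight n N k *
    ((ENNReal.ofReal (l k / (m + 1)))⁻¹ * {t : ℝ | |t| ≤ l k / 2}.indicator 1 t)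

/-- The product of the densities of the first `i` blocks `Ico (b j) (b (j + 1))`. -/
noncomputable def cascadeDensity (ρ : Measure ℝ) (l : ℕ → ℝ) (b : ℕ → ℕ) (y : ℕ → ℝ) :
    ℕ → ℝ → ℝ≥0∞
  | 0 => fun _ => 1
  | i + 1 => fun x => cascadeDensity ρ l b y i x * blockDensity ρ l (b i) (b (i + 1)) y x

/-- The bound for the two-point correlation of `cascadeDensity`. -/
noncomputable def cascadeBound (l : ℕ → ℝ) (m : ℕ) (b : ℕ → ℕ) : ℕ → ℝ → ℝ≥0∞
  | 0 => fun _ => 1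
  | i + 1 => fun t => cascadeBound l m b i t * (1 + blockExcess l m (b i) (b (i + 1)) t)

/-! ### Independence of blocks and correlations of the cascade -/

lemma measurable_iSup_comap {Ω : Type*} {c : ℕ → Ω → ℝ} {S : Set ℕ} {k : ℕ} (hk : k ∈ S) :
    Measurable[⨆ k ∈ S, MeasurableSpace.comap (c k) inferInstance] (c k) := by
  rw [measurable_iff_comap_le]
  exact le_iSup₂_of_le k hk le_rfl

lemma measurable_blockDensity_iSup {Ω : Type*} {c : ℕ → Ω → ℝ} {ρ : Measure ℝ} [SFinite ρ] {l : ℕ → ℝ} {S : Set ℕ} {n N : ℕ}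
    (hS : ∀ k, n ≤ k → k < N → k ∈ S) (x : ℝ) :
    Measurable[⨆ k ∈ S, MeasurableSpace.comap (c k) inferInstance]
      fun ω => blockDensity ρ l n N (fun k => c k ω) x := by
  unfold blockDensity
  refine Finset.measurable_sum _ fun k hk => Measurable.const_mul ?_ _
  have hk' := Finset.mem_Ico.1 hk
  exact (measurable_hit_left ρ l k x).comp (measurable_iSup_comap (hS k hk'.1 hk'.2))

lemma measurable_cascadeDensity_iSup {Ω : Type*} {c : ℕ → Ω → ℝ} {ρ : Measure ℝ} [SFinite ρ] {l : ℕ → ℝ} {b : ℕ → ℕ} (hb : StrictMono b) (i : ℕ) (x : ℝ) :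
    Measurable[⨆ k ∈ Iio (b i), MeasurableSpace.comap (c k) inferInstance]
      fun ω => cascadeDensity ρ l b (fun k => c k ω) i x := by
  induction i with
  | zero => exact measurable_const
  | succ i ih =>
    refine Measurable.mul (ih.mono ?_ le_rfl) ?_
    · exact biSup_mono fun k hk => lt_of_lt_of_le hk (hb.monotone i.le_succ)
    · exact measurable_blockDensity_iSup (fun k _ hk => hk) x

section Random

variable {Ω : Type*} [MeasurableSpace Ω] {P : Measure Ω} {c : ℕ → Ω → ℝ} {ρ : Measure ℝ}
  {l : ℕ → ℝ}

lemma measurable_blockDensity [SFinite ρ] (hc : ∀ k, Measurable (c k)) (n N : ℕ) :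
    Measurable fun p : Ω × ℝ => blockDensity ρ l n N (fun k => c k p.1) p.2 := by
  unfold blockDensity
  refine Finset.measurable_sum _ fun k _ => Measurable.const_mul ?_ _
  exact (measurable_hit ρ l k).comp (((hc k).comp measurable_fst).prodMk measurable_snd)

lemma measurable_cascadeDensity [SFinite ρ] (hc : ∀ k, Measurable (c k)) (b : ℕ → ℕ) (i : ℕ) :
    Measurable fun p : Ω × ℝ => cascadeDensity ρ l b (fun k => c k p.1) i p.2 := by
  induction i with
  | zero => exact measurable_const
  | succ i ih => exact ih.mul (measurable_blockDensity hc _ _)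

lemma lintegral_comp_of_map_eq (hc : ∀ k, Measurable (c k)) (hlaw : ∀ k, P.map (c k) = ρ) (k : ℕ)
    {g : ℝ → ℝ≥0∞} (hg : Measurable g) : ∫⁻ ω, g (c k ω) ∂P = ∫⁻ z, g z ∂ρ := by
  rw [← hlaw k, lintegral_map hg (hc k)]

lemma lintegral_blockDensity [IsFiniteMeasure ρ] (hc : ∀ k, Measurable (c k))
    (hlaw : ∀ k, P.map (c k) = ρ) (hl : ∀ k, 0 < l k) {m n N : ℕ} (hm : m ≤ n) (hn : 1 ≤ n)
    (hN : n < N) {x : ℝ} (hx : x ∈ lowerDensitySet ρ l m) :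
    ∫⁻ ω, blockDensity ρ l n N (fun k => c k ω) x ∂P = 1 := by
  unfold blockDensity
  have hmeas : ∀ k, Measurable fun ω => hit ρ l k (c k ω) x :=
    fun k => (measurable_hit_left ρ l k x).comp (hc k)
  rw [lintegral_finsetSum _ fun k _ => (hmeas k).const_mul _, ← sum_blockWeight hn hN]
  refine Finset.sum_congr rfl fun k hk => ?_
  rw [lintegral_const_mul _ (hmeas k)]
  rw [lintegral_comp_of_map_eq hc hlaw k (measurable_hit_left ρ l k x),
    lintegral_hit hl hx (hm.trans (Finset.mem_Ico.1 hk).1), mul_one]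

lemma lintegral_blockDensity_mul_le [IsFiniteMeasure ρ] (hc : ∀ k, Measurable (c k))
    (hind : iIndepFun c P)
    (hlaw : ∀ k, P.map (c k) = ρ) (hl : ∀ k, 0 < l k) {m n N : ℕ} (hm : m ≤ n) (hn : 1 ≤ n)
    (hN : n < N) {x y : ℝ} (hx : x ∈ lowerDensitySet ρ l m) (hy : y ∈ lowerDensitySet ρ l m) :
    ∫⁻ ω, blockDensity ρ l n N (fun k => c k ω) x * blockDensity ρ l n N (fun k => c k ω) y ∂P ≤
      1 + blockExcess l m n N (x - y) := by
  unfold blockDensity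
  have hmeas : ∀ k x, Measurable fun ω => hit ρ l k (c k ω) x :=
    fun k x => (measurable_hit_left ρ l k x).comp (hc k)
  have hmeas2 : ∀ k k', Measurable fun ω => blockWeight n N k * hit ρ l k (c k ω) x *
      (blockWeight n N k' * hit ρ l k' (c k' ω) y) := fun k k' =>
    ((hmeas k x).const_mul _).mul ((hmeas k' y).const_mul _)
  simp only [Finset.sum_mul_sum]
  rw [lintegral_finsetSum _ fun k _ => Finset.measurable_sum _ fun k' _ => hmeas2 k k']
  -- Distinct indices factor by independence. The product of weights is kept on the diagonal too,
  -- where it is superfluous, so that it sums over all pairs to `(∑ w)² = 1`.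
  have hpair : ∀ k ∈ Finset.Ico n N, ∀ k' ∈ Finset.Ico n N,
      ∫⁻ ω, blockWeight n N k * hit ρ l k (c k ω) x * (blockWeight n N k' * hit ρ l k' (c k' ω) y) ∂P ≤
      blockWeight n N k * blockWeight n N k' + if k = k' then blockWeight n N k * blockWeight n N k *
        ((ENNReal.ofReal (l k / (m + 1)))⁻¹ * {t : ℝ | |t| ≤ l k / 2}.indicator 1 (x - y)) else 0 := by
    intro k hk k' hk'
    have h1 : ∫⁻ ω, blockWeight n N k * hit ρ l k (c k ω) x *
        (blockWeight n N k' * hit ρ l k' (c k' ω) y) ∂P = blockWeight n N k * blockWeight n N k' *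
        ∫⁻ ω, hit ρ l k (c k ω) x * hit ρ l k' (c k' ω) y ∂P := by
      refine Eq.trans ?_ (lintegral_const_mul _ ((hmeas k x).mul (hmeas k' y)))
      refine lintegral_congr fun ω => ?_
      ring
    rw [h1]
    rcases eq_or_ne k k' with rfl | hkk
    · rw [if_pos rfl]
      refine le_trans ?_ le_add_self
      gcongr
      rw [lintegral_comp_of_map_eq (g := fun z => hit ρ l k z x * hit ρ l k z y) hc hlaw k
        ((measurable_hit_left ρ l k x).mul (measurable_hit_left ρ l k y))]
      exact lintegral_hit_mul_hit_le hl hx hy (hm.trans (Finset.mem_Ico.1 hk).1)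
    · rw [if_neg hkk, add_zero]
      have h2 := lintegral_mul_eq_lintegral_mul_lintegral_of_indepFun (μ := P) (hmeas k x)
        (hmeas k' y) ((hind.indepFun hkk).comp (measurable_hit_left ρ l k x)
          (measurable_hit_left ρ l k' y))
      have h3 : ∫⁻ ω, hit ρ l k (c k ω) x * hit ρ l k' (c k' ω) y ∂P = 1 := by
        refine h2.trans ?_
        rw [lintegral_comp_of_map_eq hc hlaw k (measurable_hit_left ρ l k x),
          lintegral_comp_of_map_eq hc hlaw k' (measurable_hit_left ρ l k' y),
          lintegral_hit hl hx (hm.trans (Finset.mem_Ico.1 hk).1),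
          lintegral_hit hl hy (hm.trans (Finset.mem_Ico.1 hk').1), mul_one]
      rw [h3, mul_one]
  calc _ ≤ ∑ k ∈ Finset.Ico n N, ∑ k' ∈ Finset.Ico n N, (blockWeight n N k * blockWeight n N k' +
        if k = k' then blockWeight n N k * blockWeight n N k *
        ((ENNReal.ofReal (l k / (m + 1)))⁻¹ * {t : ℝ | |t| ≤ l k / 2}.indicator 1 (x - y)) else 0) := by
        refine Finset.sum_le_sum fun k hk => ?_
        rw [lintegral_finsetSum _ fun k' _ => hmeas2 k k']
        exact Finset.sum_le_sum fun k' hk' => hpair k hk k' hk'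
    _ = _ := by
        simp only [Finset.sum_add_distrib]
        rw [← Finset.sum_mul_sum, sum_blockWeight hn hN, one_mul]
        congr 1
        unfold blockExcess
        refine Finset.sum_congr rfl fun k hk => ?_
        rw [Finset.sum_ite_eq, if_pos hk]

/-- Functions of the variables before `n` and from `n` on have multiplicative integrals. -/
lemma lintegral_mul_of_lt_of_ge (hc : ∀ k, Measurable (c k)) (hind : iIndepFun c P) (n : ℕ)
    {f g : Ω → ℝ≥0∞}
    (hf : Measurable[⨆ k ∈ Iio n, MeasurableSpace.comap (c k) inferInstance] f)
    (hg : Measurable[⨆ k ∈ Ici n, MeasurableSpace.comap (c k) inferInstance] g) :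
    ∫⁻ ω, f ω * g ω ∂P = (∫⁻ ω, f ω ∂P) * ∫⁻ ω, g ω ∂P := by
  have hle : ∀ k, MeasurableSpace.comap (c k) inferInstance ≤ (inferInstance : MeasurableSpace Ω) :=
    fun k => (hc k).comap_le
  refine lintegral_mul_eq_lintegral_mul_lintegral_of_independent_measurableSpace
    (iSup₂_le fun k _ => hle k) (iSup₂_le fun k _ => hle k) ?_ hf hg
  refine indep_iSup_of_disjoint hle hind ?_
  exact disjoint_left.2 fun k hk hk' => not_lt.2 (mem_Ici.1 hk') (mem_Iio.1 hk)

lemma lintegral_cascadeDensity [IsProbabilityMeasure P] [IsFiniteMeasure ρ]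
    (hc : ∀ k, Measurable (c k)) (hind : iIndepFun c P)
    (hlaw : ∀ k, P.map (c k) = ρ) (hl : ∀ k, 0 < l k) {m : ℕ} {b : ℕ → ℕ} (hb : StrictMono b)
    (hm : m ≤ b 0) (hb1 : 1 ≤ b 0) {x : ℝ} (hx : x ∈ lowerDensitySet ρ l m) (i : ℕ) :
    ∫⁻ ω, cascadeDensity ρ l b (fun k => c k ω) i x ∂P = 1 := by
  induction i with
  | zero => simp [cascadeDensity]
  | succ i ih =>
    have hbi := hb.monotone i.zero_le
    simp only [cascadeDensity]
    rw [lintegral_mul_of_lt_of_ge hc hind (b i) (measurable_cascadeDensity_iSup hb i x)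
      (measurable_blockDensity_iSup (fun k hk _ => hk) x), ih,
      lintegral_blockDensity hc hlaw hl (hm.trans hbi) (hb1.trans hbi) (hb i.lt_succ_self) hx, one_mul]

lemma lintegral_cascadeDensity_mul_le [IsProbabilityMeasure P] [IsFiniteMeasure ρ]
    (hc : ∀ k, Measurable (c k)) (hind : iIndepFun c P)
    (hlaw : ∀ k, P.map (c k) = ρ) (hl : ∀ k, 0 < l k) {m : ℕ} {b : ℕ → ℕ} (hb : StrictMono b)
    (hm : m ≤ b 0) (hb1 : 1 ≤ b 0) {x y : ℝ} (hx : x ∈ lowerDensitySet ρ l m)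
    (hy : y ∈ lowerDensitySet ρ l m) (i : ℕ) :
    ∫⁻ ω, cascadeDensity ρ l b (fun k => c k ω) i x * cascadeDensity ρ l b (fun k => c k ω) i y ∂P ≤
      cascadeBound l m b i (x - y) := by
  induction i with
  | zero => simp [cascadeDensity, cascadeBound]
  | succ i ih =>
    have hbi := hb.monotone i.zero_le
    simp only [cascadeDensity, cascadeBound]
    have h1 : ∀ ω, cascadeDensity ρ l b (fun k => c k ω) i x *
        blockDensity ρ l (b i) (b (i + 1)) (fun k => c k ω) x *
        (cascadeDensity ρ l b (fun k => c k ω) i y *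
          blockDensity ρ l (b i) (b (i + 1)) (fun k => c k ω) y) =
        (cascadeDensity ρ l b (fun k => c k ω) i x * cascadeDensity ρ l b (fun k => c k ω) i y) *
        (blockDensity ρ l (b i) (b (i + 1)) (fun k => c k ω) x *
          blockDensity ρ l (b i) (b (i + 1)) (fun k => c k ω) y) := fun ω => by ring
    simp only [h1]
    refine (lintegral_mul_of_lt_of_ge hc hind (b i)
      ((measurable_cascadeDensity_iSup hb i x).mul (measurable_cascadeDensity_iSup hb i y))
      ((measurable_blockDensity_iSup (fun k hk _ => hk) x).mul
        (measurable_blockDensity_iSup (fun k hk _ => hk) y))).trans_le ?_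
    refine mul_le_mul' ih ?_
    exact lintegral_blockDensity_mul_le hc hind hlaw hl (hm.trans hbi) (hb1.trans hbi)
      (hb i.lt_succ_self) hx hy

end Random

/-! ### The compact sets carrying the cascade -/

lemma exists_mem_closedBall_of_blockDensity_ne_zero {ρ : Measure ℝ} {l : ℕ → ℝ} {n N : ℕ} {y : ℕ → ℝ}
    {x : ℝ} (h : blockDensity ρ l n N y x ≠ 0) :
    ∃ k ∈ Finset.Ico n N, x ∈ Metric.closedBall (y k) (l k / 4) := by
  obtain ⟨k, hk, hne⟩ := Finset.exists_ne_zero_of_sum_ne_zero h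
  refine ⟨k, hk, ?_⟩
  by_contra hx
  apply hne
  unfold hit
  rw [indicator_of_notMem]
  · simp
  · rwa [Metric.mem_closedBall_comm] at hx

/-- The compact set carrying the density of the first `i` blocks. -/
def cascadeSet (l : ℕ → ℝ) (b : ℕ → ℕ) (y : ℕ → ℝ) (i : ℕ) : Set ℝ :=
  ⋂ j < i, ⋃ k ∈ Finset.Ico (b j) (b (j + 1)), Metric.closedBall (y k) (l k / 4)

lemma isClosed_cascadeSet (l : ℕ → ℝ) (b : ℕ → ℕ) (y : ℕ → ℝ) (i : ℕ) :
    IsClosed (cascadeSet l b y i) :=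
  isClosed_biInter fun _ _ => isClosed_biUnion_finset fun _ _ => Metric.isClosed_closedBall

lemma antitone_cascadeSet (l : ℕ → ℝ) (b : ℕ → ℕ) (y : ℕ → ℝ) : Antitone (cascadeSet l b y) :=
  fun _ _ hij => biInter_subset_biInter_left fun _ hk => lt_of_lt_of_le hk hij

/-- Block `m` only has indices `k ≥ b m ≥ m`, and the closed ball of radius `l k / 4` lies inside
the open interval of half-length `l k / 2`. -/
lemma iInter_cascadeSet_subset {l : ℕ → ℝ} (hl : ∀ k, 0 < l k) {b : ℕ → ℕ} (hb : StrictMono b)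
    (y : ℕ → ℝ) : ⋂ i, cascadeSet l b y i ⊆ limsupIntervals y l := by
  intro x hx
  refine mem_iInter.2 fun m => ?_
  have h1 := mem_iInter₂.1 (mem_iInter.1 hx (m + 1)) m (Nat.lt_succ_self m)
  obtain ⟨k, hk, hxk⟩ := mem_iUnion₂.1 h1
  refine mem_iUnion₂.2 ⟨k, (hb.le_apply).trans (Finset.mem_Ico.1 hk).1, ?_⟩
  rw [Metric.mem_closedBall, Real.dist_eq] at hxk
  have h2 := abs_le.1 hxk
  have h3 := hl k
  exact ⟨by linarith, by linarith⟩

lemma mem_cascadeSet_of_ne_zero {ρ : Measure ℝ} {l : ℕ → ℝ} {b : ℕ → ℕ} {y : ℕ → ℝ} {i : ℕ}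
    {x : ℝ} (h : cascadeDensity ρ l b y i x ≠ 0) : x ∈ cascadeSet l b y i := by
  induction i with
  | zero => simp [cascadeSet]
  | succ i ih =>
    simp only [cascadeDensity] at h
    have h1 := ih (left_ne_zero_of_mul h)
    refine mem_iInter₂.2 fun j hj => ?_
    rcases Nat.lt_succ_iff_lt_or_eq.1 hj with hj | rfl
    · exact mem_iInter₂.1 h1 j hj
    · obtain ⟨k, hk, hx⟩ := exists_mem_closedBall_of_blockDensity_ne_zero (right_ne_zero_of_mul h)
      exact mem_iUnion₂.2 ⟨k, hk, hx⟩

/-! ### Energy cost of a block and choice of the blocks -/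

lemma measurable_blockExcess (l : ℕ → ℝ) (m n N : ℕ) : Measurable (blockExcess l m n N) := by
  unfold blockExcess
  refine Finset.measurable_sum _ fun k _ => Measurable.const_mul (Measurable.const_mul ?_ _) _
  exact measurable_one.indicator (measurableSet_le (by fun_prop) measurable_const)

lemma measurable_cascadeBound (l : ℕ → ℝ) (m : ℕ) (b : ℕ → ℕ) (i : ℕ) :
    Measurable (cascadeBound l m b i) := by
  induction i with
  | zero => exact measurable_const
  | succ i ih => exact ih.mul (measurable_const.add (measurable_blockExcess _ _ _ _))

lemma blockExcess_le (l : ℕ → ℝ) (m n N : ℕ) (t : ℝ) :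
    blockExcess l m n N t ≤ ∑ k ∈ Finset.Ico n N, blockWeight n N k * blockWeight n N k *
      (ENNReal.ofReal (l k / (m + 1)))⁻¹ := by
  unfold blockExcess
  refine Finset.sum_le_sum fun k _ => mul_le_mul_right ?_ _
  refine mul_le_of_le_one_right' ?_
  exact indicator_le_self' (by simp) t

lemma sum_blockWeight_sq_mul_ne_top {l : ℕ → ℝ} (hl : ∀ k, 0 < l k) (m : ℕ) {n N : ℕ} (hn : 1 ≤ n)
    (hN : n < N) : ∑ k ∈ Finset.Ico n N, blockWeight n N k * blockWeight n N k *
      (ENNReal.ofReal (l k / (m + 1)))⁻¹ ≠ ⊤ := by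
  refine ENNReal.sum_ne_top.2 fun k hk => ?_
  have h1 : blockWeight n N k ≠ ⊤ := by
    refine ne_top_of_le_ne_top ENNReal.one_ne_top ?_
    rw [← sum_blockWeight hn hN]
    exact Finset.single_le_sum (fun _ _ => zero_le) hk
  refine ENNReal.mul_ne_top (ENNReal.mul_ne_top h1 h1) (ENNReal.inv_ne_top.2 ?_)
  have := hl k
  exact (ENNReal.ofReal_pos.2 (by positivity)).ne'

/-- For `|t| ≤ r` split `log (R / |t|)` into `log (R / r)`, constant on an interval of length `2 *
r`, and `log (r / |t|)`, of integral `2 * r`. -/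
lemma lintegral_posLogKernel_mul_indicator_le {R : ℝ} (hR : 0 < R) {D : ℝ≥0∞} {ν : Measure ℝ}
    [IsProbabilityMeasure ν] (hν : ν ≤ D • volume) {r : ℝ} (hr : 0 < r) :
    ∫⁻ p, posLogKernel R (p.1 - p.2) * {t : ℝ | |t| ≤ r}.indicator 1 (p.1 - p.2) ∂(ν.prod ν) ≤
      D * (ENNReal.ofReal (2 * r) * (ENNReal.ofReal (Real.log (R / r)) + 1)) := by
  have hms : MeasurableSet {t : ℝ | |t| ≤ r} := measurableSet_le (by fun_prop) measurable_const
  have hmi : Measurable ({t : ℝ | |t| ≤ r}.indicator (1 : ℝ → ℝ≥0∞)) := measurable_one.indicator hms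
  have hmp : Measurable fun p : ℝ × ℝ =>
      posLogKernel R (p.1 - p.2) * {t : ℝ | |t| ≤ r}.indicator (1 : ℝ → ℝ≥0∞) (p.1 - p.2) :=
    ((measurable_posLogKernel R).mul hmi).comp (measurable_fst.sub measurable_snd)
  rw [lintegral_prod _ hmp.aemeasurable]
  calc _ ≤ ∫⁻ x, D * (ENNReal.ofReal (2 * r) * (ENNReal.ofReal (Real.log (R / r)) + 1)) ∂ν := by
        refine lintegral_mono fun x => ?_
        calc _ ≤ ∫⁻ y, posLogKernel R (x - y) * {t : ℝ | |t| ≤ r}.indicator 1 (x - y)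
              ∂(D • volume) := lintegral_mono' hν le_rfl
          _ = D * ∫⁻ t, posLogKernel R t * {t : ℝ | |t| ≤ r}.indicator 1 t := by
              rw [lintegral_smul_measure, smul_eq_mul,
                lintegral_sub_left_eq_self
                  (fun t => posLogKernel R t * {t : ℝ | |t| ≤ r}.indicator 1 t) x]
          _ ≤ D * ∫⁻ t, (ENNReal.ofReal (Real.log (R / r)) * {t : ℝ | |t| ≤ r}.indicator 1 t +
                posLogKernel r t) := by
              gcongr with t
              by_cases ht : t ∈ {t : ℝ | |t| ≤ r}
              · rw [indicator_of_mem ht]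
                simpa using posLogKernel_add_le hr hR
              · simp [indicator_of_notMem ht]
          _ = _ := by
              rw [lintegral_add_left (hmi.const_mul _), lintegral_const_mul _ hmi,
                lintegral_indicator_one hms, lintegral_posLogKernel hr]
              have : {t : ℝ | |t| ≤ r} = Icc (-r) r := by ext t; simp [abs_le]
              rw [this, Real.volume_Icc, show r - -r = 2 * r by ring]
              ring
    _ = _ := by simp

/-- In the `k`-th term the kernel contributes at most `D * l k * A * k`; the length `l k` cancels
against the correlation bound `(m + 1) / l k`, and what remains is the weighted sum that the
harmonic weights make small. -/
lemma lintegral_posLogKernel_mul_blockExcess_le {R : ℝ} (hR : 0 < R) {D : ℝ≥0∞} {ν : Measure ℝ}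
    [IsProbabilityMeasure ν] (hν : ν ≤ D • volume) {l : ℕ → ℝ} (hl : ∀ k, 0 < l k) {A : ℝ≥0∞}
    (hA : ∀ k, 1 ≤ k → ENNReal.ofReal (Real.log (R / (l k / 2))) + 1 ≤ A * k) (m : ℕ) {n N : ℕ}
    (hn : 1 ≤ n) (hN : n < N) :
    ∫⁻ p, posLogKernel R (p.1 - p.2) * blockExcess l m n N (p.1 - p.2) ∂(ν.prod ν) ≤
      D * A * (m + 1) * (blockSum n N)⁻¹ := by
  unfold blockExcess
  simp only [Finset.mul_sum]
  have hmi : ∀ k, Measurable fun p : ℝ × ℝ => posLogKernel R (p.1 - p.2) *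
      {t : ℝ | |t| ≤ l k / 2}.indicator (1 : ℝ → ℝ≥0∞) (p.1 - p.2) := fun k =>
    ((measurable_posLogKernel R).comp (by fun_prop)).mul
      ((measurable_one.indicator (measurableSet_le (by fun_prop) measurable_const)).comp
        (measurable_fst.sub measurable_snd))
  have hre : ∀ (k : ℕ) (p : ℝ × ℝ), posLogKernel R (p.1 - p.2) *
      (blockWeight n N k * blockWeight n N k * ((ENNReal.ofReal (l k / (m + 1)))⁻¹ *
        {t : ℝ | |t| ≤ l k / 2}.indicator 1 (p.1 - p.2))) =
      blockWeight n N k * blockWeight n N k * (ENNReal.ofReal (l k / (m + 1)))⁻¹ *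
        (posLogKernel R (p.1 - p.2) * {t : ℝ | |t| ≤ l k / 2}.indicator 1 (p.1 - p.2)) :=
    fun k p => by ring
  simp only [hre]
  rw [lintegral_finsetSum _ fun k _ => (hmi k).const_mul _, ← sum_sq_blockWeight_mul hn hN,
    Finset.mul_sum]
  refine Finset.sum_le_sum fun k hk => ?_
  rw [lintegral_const_mul _ (hmi k)]
  have hlk := hl k
  have h1 := lintegral_posLogKernel_mul_indicator_le hR hν (r := l k / 2) (by positivity)
  rw [show 2 * (l k / 2) = l k by ring] at h1
  have h2 : (ENNReal.ofReal (l k / (m + 1)))⁻¹ * ENNReal.ofReal (l k) = m + 1 := by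
    rw [← ENNReal.ofReal_inv_of_pos (by positivity), ← ENNReal.ofReal_mul (by positivity)]
    rw [show (l k / ((m : ℝ) + 1))⁻¹ * l k = ((m + 1 : ℕ) : ℝ) by push_cast; field_simp,
      ENNReal.ofReal_natCast]
    push_cast
    rfl
  calc _ ≤ blockWeight n N k * blockWeight n N k * (ENNReal.ofReal (l k / (m + 1)))⁻¹ *
        (D * (ENNReal.ofReal (l k) * (A * k))) := by
        gcongr
        refine h1.trans ?_
        gcongr
        exact hA k (hn.trans (Finset.mem_Ico.1 hk).1)
    _ = D * A * ((ENNReal.ofReal (l k / (m + 1)))⁻¹ * ENNReal.ofReal (l k)) *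
        (blockWeight n N k * blockWeight n N k * k) := by ring
    _ = _ := by rw [h2]

/-- Blocks can be chosen inductively so that the energy grows by arbitrarily little. -/
lemma exists_blocks {R : ℝ} (hR : 0 < R) {D : ℝ≥0∞} (hD : D ≠ ⊤) {ν : Measure ℝ}
    [IsProbabilityMeasure ν] (hν : ν ≤ D • volume) {l : ℕ → ℝ} (hl : ∀ k, 0 < l k) {A : ℝ≥0∞}
    (hAtop : A ≠ ⊤)
    (hA : ∀ k, 1 ≤ k → ENNReal.ofReal (Real.log (R / (l k / 2))) + 1 ≤ A * k) (m : ℕ)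
    {ε : ℕ → ℝ≥0∞} (hε : ∀ i, 0 < ε i) :
    ∃ b : ℕ → ℕ, StrictMono b ∧ m ≤ b 0 ∧ 1 ≤ b 0 ∧ ∀ i,
      ∫⁻ p, posLogKernel R (p.1 - p.2) * (cascadeBound l m b i (p.1 - p.2) *
        blockExcess l m (b i) (b (i + 1)) (p.1 - p.2)) ∂(ν.prod ν) ≤ ε i := by
  -- `C` is to be a uniform bound for the cascade built so far. Its finiteness is a premise of the
  -- estimate only, so that `next` can be chosen as a total function.
  have hstep : ∀ (i n : ℕ) (C : ℝ≥0∞), ∃ N, n < N ∧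
      (C ≠ ⊤ → C * (D * A * (m + 1) * (blockSum n N)⁻¹) ≤ ε i) := by
    intro i n C
    by_cases hC : C = ⊤
    · exact ⟨n + 1, n.lt_succ_self, fun h => absurd hC h⟩
    have h1 : Tendsto (fun N => (blockSum n N)⁻¹) atTop (𝓝 0) := by
      simpa using tendsto_inv_iff.2 (tendsto_blockSum n)
    have hK : C * (D * A * (m + 1)) ≠ ⊤ :=
      ENNReal.mul_ne_top hC (ENNReal.mul_ne_top (ENNReal.mul_ne_top hD hAtop)
        (ENNReal.add_ne_top.2 ⟨ENNReal.natCast_ne_top m, ENNReal.one_ne_top⟩))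
    have h2 := ENNReal.Tendsto.const_mul h1 (Or.inr hK)
    rw [mul_zero] at h2
    obtain ⟨N, hN1, hN2⟩ := ((h2.eventually_lt_const (hε i)).and (eventually_gt_atTop n)).exists
    exact ⟨N, hN2, fun _ => by rw [← mul_assoc]; exact hN1.le⟩
  choose next hnext1 hnext2 using hstep
  let T : ℕ → ℕ → ℝ≥0∞ := fun n N => ∑ k ∈ Finset.Ico n N, blockWeight n N k * blockWeight n N k *
      (ENNReal.ofReal (l k / (m + 1)))⁻¹
  -- The state records where the next block starts and a constant bounding `cascadeBound` up to
  -- there.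
  let s : ℕ → ℕ × ℝ≥0∞ := fun i => Nat.rec (max m 1, 1)
    (fun i p => (next i p.1 p.2, p.2 * (1 + T p.1 (next i p.1 p.2)))) i
  have hs : ∀ i, s (i + 1) = (next i (s i).1 (s i).2,
    (s i).2 * (1 + T (s i).1 (next i (s i).1 (s i).2))) := fun i => rfl
  have hmono : StrictMono fun i => (s i).1 := strictMono_nat_of_lt_succ fun i => by
    rw [hs i]; exact hnext1 i _ _
  have h1le : ∀ i, 1 ≤ (s i).1 := fun i =>
    (le_max_right m 1).trans (hmono.monotone i.zero_le)
  have hfin : ∀ i, (s i).2 ≠ ⊤ := by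
    intro i
    induction i with
    | zero => exact ENNReal.one_ne_top
    | succ i ih =>
      rw [hs i]
      exact ENNReal.mul_ne_top ih (ENNReal.add_ne_top.2 ⟨ENNReal.one_ne_top,
        sum_blockWeight_sq_mul_ne_top hl m (h1le i) (hnext1 i _ _)⟩)
  have hbound : ∀ i t, cascadeBound l m (fun i => (s i).1) i t ≤ (s i).2 := by
    intro i
    induction i with
    | zero => exact fun t => le_rfl
    | succ i ih =>
      intro t
      have : (s (i + 1)).2 = (s i).2 * (1 + T (s i).1 (s (i + 1)).1) := by rw [hs i]
      rw [this]
      refine mul_le_mul' (ih t) (add_le_add_right ?_ _)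
      exact blockExcess_le _ _ _ _ _
  refine ⟨fun i => (s i).1, hmono, le_max_left _ _, le_max_right _ _, fun i => ?_⟩
  refine le_trans ?_ (hnext2 i (s i).1 (s i).2 (hfin i))
  have hN : next i (s i).1 (s i).2 = (s (i + 1)).1 := by rw [hs i]
  rw [hN]
  have hmeas : Measurable fun p : ℝ × ℝ => posLogKernel R (p.1 - p.2) *
      blockExcess l m (s i).1 (s (i + 1)).1 (p.1 - p.2) :=
    ((measurable_posLogKernel R).mul (measurable_blockExcess l m _ _)).comp
      (measurable_fst.sub measurable_snd)
  calc _ ≤ ∫⁻ p, (s i).2 * (posLogKernel R (p.1 - p.2) *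
        blockExcess l m (s i).1 (s (i + 1)).1 (p.1 - p.2)) ∂(ν.prod ν) := by
        refine lintegral_mono fun p => ?_
        simp only
        rw [mul_left_comm]
        gcongr
        exact hbound i _
    _ ≤ _ := by
        rw [lintegral_const_mul _ hmeas]
        gcongr
        exact lintegral_posLogKernel_mul_blockExcess_le hR hν hl hA m (h1le i)
          (hmono i.lt_succ_self)

/-- Telescoping: passing from stage `i` to `i + 1` adds exactly the term estimated in `h i`. -/
lemma lintegral_cascadeBound_le {ν : Measure ℝ} [SFinite ν] {l : ℕ → ℝ} {m : ℕ} {b : ℕ → ℕ}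
    {g : ℝ → ℝ≥0∞} (hg : Measurable g) {ε : ℕ → ℝ≥0∞}
    (h : ∀ i, ∫⁻ p, g (p.1 - p.2) * (cascadeBound l m b i (p.1 - p.2) *
        blockExcess l m (b i) (b (i + 1)) (p.1 - p.2)) ∂(ν.prod ν) ≤ ε i) (i : ℕ) :
    ∫⁻ p, g (p.1 - p.2) * cascadeBound l m b i (p.1 - p.2) ∂(ν.prod ν) ≤
      ∫⁻ p, g (p.1 - p.2) ∂(ν.prod ν) + ∑' j, ε j := by
  have hfin : ∫⁻ p, g (p.1 - p.2) * cascadeBound l m b i (p.1 - p.2) ∂(ν.prod ν) ≤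
      ∫⁻ p, g (p.1 - p.2) ∂(ν.prod ν) + ∑ j ∈ Finset.range i, ε j := by
    induction i with
    | zero => simp [cascadeBound]
    | succ i ih =>
      rw [Finset.sum_range_succ, ← add_assoc]
      have hm1 : Measurable fun p : ℝ × ℝ => g (p.1 - p.2) * cascadeBound l m b i (p.1 - p.2) :=
        (hg.mul (measurable_cascadeBound l m b i)).comp (measurable_fst.sub measurable_snd)
      refine le_trans (le_of_eq ?_) (add_le_add ih (h i))
      rw [← lintegral_add_left hm1]
      refine lintegral_congr fun p => ?_
      simp only [cascadeBound]
      ring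
  exact hfin.trans (by gcongr; exact ENNReal.sum_le_tsum _)

/-! ### Normalisation and second-moment inequalities -/

lemma posLogEnergy_withDensity (R : ℝ) {ν : Measure ℝ} [IsProbabilityMeasure ν] {w : ℝ → ℝ≥0∞}
    (hw : Measurable w) : posLogEnergy R (ν.withDensity w) =
      ∫⁻ p, posLogKernel R (p.1 - p.2) * (w p.1 * w p.2) ∂(ν.prod ν) := by
  rw [posLogEnergy_eq_lintegral_prod, prod_withDensity hw hw,
    lintegral_withDensity_eq_lintegral_mul _ (by fun_prop) (by fun_prop)]
  refine lintegral_congr fun p => ?_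
  simp only [Pi.mul_apply]
  ring

/-- Normalisation of `ν.withDensity w` to a probability measure. -/
lemma exists_normalized_withDensity {R : ℝ} {ν : Measure ℝ} [IsProbabilityMeasure ν]
    {w : ℝ → ℝ≥0∞} (hw : Measurable w) (h0 : ∫⁻ x, w x ∂ν ≠ 0) (htop : ∫⁻ x, w x ∂ν ≠ ⊤)
    {K L : Set ℝ} (hK : ν Kᶜ = 0) (hL : MeasurableSet L) (hwL : ∀ x, w x ≠ 0 → x ∈ L) :
    ∃ μ : Measure ℝ, IsProbabilityMeasure μ ∧ μ (K ∩ L)ᶜ = 0 ∧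
      posLogEnergy R μ = (∫⁻ x, w x ∂ν)⁻¹ * (∫⁻ x, w x ∂ν)⁻¹ *
        ∫⁻ p, posLogKernel R (p.1 - p.2) * (w p.1 * w p.2) ∂(ν.prod ν) := by
  refine ⟨(∫⁻ x, w x ∂ν)⁻¹ • ν.withDensity w, ⟨?_⟩, ?_, ?_⟩
  · rw [Measure.smul_apply, withDensity_apply _ MeasurableSet.univ, Measure.restrict_univ, smul_eq_mul,
      ENNReal.inv_mul_cancel h0 htop]
  · rw [Measure.smul_apply, smul_eq_mul, compl_inter]
    refine mul_eq_zero_of_right _ (measure_union_null (withDensity_absolutelyContinuous _ _ hK) ?_)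
    rw [withDensity_apply _ hL.compl, setLIntegral_eq_zero_iff hL.compl hw]
    refine Eventually.of_forall fun x hx => ?_
    by_contra h
    exact hx (hwL x h)
  · rw [posLogEnergy_smul, posLogEnergy_withDensity R hw]

lemma two_mul_le_sq_add_one (m : ℝ≥0∞) : 2 * m ≤ m * m + 1 := by
  rcases eq_or_ne m ⊤ with rfl | hm
  · simp
  lift m to ℝ≥0 using hm
  have : 2 * m ≤ m * m + 1 := by
    rw [← NNReal.coe_le_coe]
    push_cast
    nlinarith [sq_nonneg ((m : ℝ) - 1)]
  exact_mod_cast this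

/-- This is `(m - 1)² ≥ 1 / 4` expanded so as to avoid truncated subtraction; it yields Chebyshev's
inequality below. -/
lemma quarter_add_two_mul_le {m : ℝ≥0∞} (h : m < 2⁻¹) : 4⁻¹ + 2 * m ≤ m * m + 1 := by
  have hm : m ≠ ⊤ := (h.trans_le le_top).ne
  lift m to ℝ≥0 using hm
  have h' : m < 2⁻¹ := by
    have h2 : ((2⁻¹ : ℝ≥0) : ℝ≥0∞) = 2⁻¹ := by rw [ENNReal.coe_inv (by norm_num)]; norm_num
    rw [← h2] at h
    exact_mod_cast h
  have h3 : (m : ℝ) < 2⁻¹ := by exact_mod_cast h'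
  have : 4⁻¹ + 2 * m ≤ m * m + 1 := by
    rw [← NNReal.coe_le_coe]
    push_cast
    nlinarith
  have h4 : ((4⁻¹ : ℝ≥0) : ℝ≥0∞) = 4⁻¹ := by rw [ENNReal.coe_inv (by norm_num)]; norm_num
  rw [← h4]
  exact_mod_cast this

section SecondMoment

variable {Ω : Type*} [MeasurableSpace Ω] {P : Measure Ω} [IsProbabilityMeasure P] {m : Ω → ℝ≥0∞}

lemma one_le_lintegral_sq (hm : Measurable m) (h1 : ∫⁻ ω, m ω ∂P = 1) :
    1 ≤ ∫⁻ ω, m ω * m ω ∂P := by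
  have h := lintegral_mono (μ := P) fun ω => two_mul_le_sq_add_one (m ω)
  rw [lintegral_const_mul _ hm, h1, lintegral_add_right _ measurable_const, lintegral_const,
    measure_univ, mul_one, mul_one, ← one_add_one_eq_two] at h
  exact (ENNReal.add_le_add_iff_right ENNReal.one_ne_top).1 h

lemma measure_lt_half_le (hm : Measurable m) (h1 : ∫⁻ ω, m ω ∂P = 1) {ε : ℝ≥0∞}
    (h2 : ∫⁻ ω, m ω * m ω ∂P ≤ 1 + ε) : P {ω | m ω < 2⁻¹} ≤ 4 * ε := by
  have hs : MeasurableSet {ω | m ω < 2⁻¹} := measurableSet_lt hm measurable_const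
  have h : ∫⁻ ω, ({ω | m ω < 2⁻¹}.indicator (fun _ => 4⁻¹) ω + 2 * m ω) ∂P ≤
      ∫⁻ ω, (m ω * m ω + 1) ∂P := by
    refine lintegral_mono fun ω => ?_
    by_cases hω : ω ∈ {ω | m ω < 2⁻¹}
    · rw [indicator_of_mem hω]
      exact quarter_add_two_mul_le hω
    · rw [indicator_of_notMem hω, zero_add]
      exact two_mul_le_sq_add_one _
  rw [lintegral_add_left (measurable_const.indicator hs), lintegral_const_mul _ hm, h1,
    lintegral_add_right _ measurable_const, lintegral_const, lintegral_indicator_const hs,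
    measure_univ, mul_one, mul_one] at h
  have h3 : 4⁻¹ * P {ω | m ω < 2⁻¹} + 2 ≤ ε + 2 :=
    h.trans ((add_le_add_left h2 1).trans (le_of_eq (by rw [← one_add_one_eq_two]; ring)))
  have h4 := (ENNReal.add_le_add_iff_right (by simp)).1 h3
  calc P {ω | m ω < 2⁻¹} = 4 * (4⁻¹ * P {ω | m ω < 2⁻¹}) := by
        rw [← mul_assoc, ENNReal.mul_inv_cancel (by simp) (by simp), one_mul]
    _ ≤ 4 * ε := by gcongr

/-- Markov's inequality for the nonnegative variable `E - V * m²`, whose mean is at most `ε` because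
`m²` has mean at least one. -/
lemma mul_measure_lt_le (hm : Measurable m) (h1 : ∫⁻ ω, m ω ∂P = 1) {E : Ω → ℝ≥0∞}
    (hE : Measurable E) {V ε ε' : ℝ≥0∞} (hV : V ≠ ⊤) (hVE : ∀ᵐ ω ∂P, V * (m ω * m ω) ≤ E ω)
    (h2 : ∫⁻ ω, E ω ∂P ≤ V + ε) : ε' * P {ω | V * (m ω * m ω) + ε' < E ω} ≤ ε := by
  have hmm : Measurable fun ω => m ω * m ω := hm.mul hm
  have hs : MeasurableSet {ω | V * (m ω * m ω) + ε' < E ω} :=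
    measurableSet_lt ((hmm.const_mul V).add_const ε') hE
  have h : ∫⁻ ω, (V * (m ω * m ω) +
      {ω | V * (m ω * m ω) + ε' < E ω}.indicator (fun _ => ε') ω) ∂P ≤ ∫⁻ ω, E ω ∂P := by
    refine lintegral_mono_ae ?_
    filter_upwards [hVE] with ω hω
    by_cases hω' : ω ∈ {ω | V * (m ω * m ω) + ε' < E ω}
    · rw [indicator_of_mem hω']
      exact le_of_lt hω'
    · rw [indicator_of_notMem hω', add_zero]
      exact hω
  rw [lintegral_add_right _ (measurable_const.indicator hs), lintegral_const_mul _ hmm,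
    lintegral_indicator_const hs] at h
  have h3 : V + ε' * P {ω | V * (m ω * m ω) + ε' < E ω} ≤ V + ε := by
    refine le_trans ?_ (h.trans h2)
    gcongr
    exact le_mul_of_one_le_right' (one_le_lintegral_sq hm h1)
  exact (ENNReal.add_le_add_iff_left hV).1 h3

end SecondMoment

/-! ### Measures of almost minimal energy on the limsup set -/

lemma measure_eventually_mem_le {Ω : Type*} [MeasurableSpace Ω] {P : Measure Ω} {B : ℕ → Set Ω}
    {η : ℝ≥0∞} (h : ∀ i, P (B i) ≤ η) : P {ω | ∀ᶠ i in atTop, ω ∈ B i} ≤ η := by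
  have h1 : {ω | ∀ᶠ i in atTop, ω ∈ B i} = ⋃ n, ⋂ i ≥ n, B i := by
    ext ω
    simp [eventually_atTop]
  have h2 : Monotone fun n => ⋂ i ≥ n, B i := fun n n' hn =>
    biInter_subset_biInter_left fun i hi => hn.trans hi
  rw [h1, h2.measure_iUnion]
  exact iSup_le fun n => (measure_mono (biInter_subset_of_mem (le_refl n))).trans (h n)

/-- Quantitative form: outside an event of small probability the limsup set carries a measure of
almost minimal energy. -/
lemma measure_not_exists_posLogEnergy_le {Ω : Type*} [MeasurableSpace Ω] {P : Measure Ω}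
    [IsProbabilityMeasure P] {c : ℕ → Ω → ℝ} {ρ : Measure ℝ} [IsFiniteMeasure ρ] {l : ℕ → ℝ}
    (hc : ∀ k, Measurable (c k)) (hind : iIndepFun c P)
    (hlaw : ∀ k, P.map (c k) = ρ) (hl : ∀ k, 0 < l k) {R : ℝ} (hR : 0 < R) {A : ℝ≥0∞}
    (hAtop : A ≠ ⊤)
    (hA : ∀ k, 1 ≤ k → ENNReal.ofReal (Real.log (R / (l k / 2))) + 1 ≤ A * k)
    {J : Set ℝ} (hJ : ∀ x ∈ J, ∀ y ∈ J, 1 ≤ posLogKernel R (x - y))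
    {ν : Measure ℝ} (hν : ν ∈ compactProbMeasures J) {D : ℝ≥0∞} (hD : D ≠ ⊤)
    (hνD : ν ≤ D • volume) {m : ℕ} (hm : ∀ᵐ x ∂ν, x ∈ lowerDensitySet ρ l m) {ε ε' : ℝ≥0∞}
    (hε : ε ≠ 0) (hε' : ε' ≠ 0) (hε't : ε' ≠ ⊤)
    (hνE : posLogEnergy R ν ≤ (⨅ μ ∈ compactProbMeasures J, posLogEnergy R μ) + ε) :
    P {ω | ¬ ∃ μ ∈ compactProbMeasures (limsupIntervals (fun k => c k ω) l),
      posLogEnergy R μ ≤ (⨅ μ ∈ compactProbMeasures J, posLogEnergy R μ) + 4 * ε'} ≤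
        4 * ε + ε'⁻¹ * (2 * ε) := by
  set V := ⨅ μ ∈ compactProbMeasures J, posLogEnergy R μ with hVdef
  have hVle : ∀ μ ∈ compactProbMeasures J, V ≤ posLogEnergy R μ := fun μ hμ => iInf₂_le μ hμ
  have hVν := hVle ν hν
  obtain ⟨hprob, Q, hQ, hQJ, hQ0⟩ := hν
  have hVtop : V ≠ ⊤ := ne_top_of_le_ne_top (posLogEnergy_ne_top hR hD hνD) hVν
  obtain ⟨e, he0, hesum⟩ := ENNReal.exists_pos_sum_of_countable' hε ℕ
  obtain ⟨b, hb, hmb, hb1, hblock⟩ := exists_blocks hR hD hνD hl hAtop hA m he0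
  have hQae : ∀ᵐ x ∂ν, x ∈ Q := hQ0
  have hκ : ∀ᵐ p ∂(ν.prod ν), 1 ≤ posLogKernel R (p.1 - p.2) := by
    filter_upwards [Measure.quasiMeasurePreserving_fst.ae hQae,
      Measure.quasiMeasurePreserving_snd.ae hQae] with p hp1 hp2
    exact hJ _ (hQJ hp1) _ (hQJ hp2)
  have hgood : ∀ᵐ p ∂(ν.prod ν), p.1 ∈ lowerDensitySet ρ l m ∧ p.2 ∈ lowerDensitySet ρ l m := by
    filter_upwards [Measure.quasiMeasurePreserving_fst.ae hm,
      Measure.quasiMeasurePreserving_snd.ae hm] with p hp1 hp2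
    exact ⟨hp1, hp2⟩
  have hsub : Measurable fun p : ℝ × ℝ => p.1 - p.2 := measurable_fst.sub measurable_snd
  -- As the kernel is at least 1 on `J`, the energy estimate for the blocks also controls the second
  -- moment of the mass.
  have hbound1 : ∀ i, ∫⁻ p, cascadeBound l m b i (p.1 - p.2) ∂(ν.prod ν) ≤ 1 + ε := by
    intro i
    have h := lintegral_cascadeBound_le (ν := ν) (l := l) (m := m) (b := b) (g := fun _ => 1)
      measurable_const (ε := e) (fun i => by
        refine le_trans (lintegral_mono_ae ?_) (hblock i)
        filter_upwards [hκ] with p hp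
        gcongr) i
    simp only [one_mul, lintegral_const, measure_univ] at h
    exact h.trans (by gcongr)
  have hbound2 : ∀ i, ∫⁻ p, posLogKernel R (p.1 - p.2) * cascadeBound l m b i (p.1 - p.2)
      ∂(ν.prod ν) ≤ V + 2 * ε := by
    intro i
    refine (lintegral_cascadeBound_le (measurable_posLogKernel R) hblock i).trans ?_
    rw [← posLogEnergy_eq_lintegral_prod]
    calc _ ≤ (V + ε) + ε := by gcongr
      _ = V + 2 * ε := by ring
  let W : ℕ → Ω → ℝ → ℝ≥0∞ := fun i ω x => cascadeDensity ρ l b (fun k => c k ω) i x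
  have hW : ∀ i, Measurable fun p : Ω × ℝ => W i p.1 p.2 := measurable_cascadeDensity hc b
  have hWω : ∀ i ω, Measurable (W i ω) := fun i ω => (hW i).comp (measurable_prodMk_left (x := ω))
  have hW1 : ∀ i, Measurable fun q : Ω × (ℝ × ℝ) => W i q.1 q.2.1 := fun i =>
    (hW i).comp (measurable_fst.prodMk (measurable_fst.comp measurable_snd))
  have hW2 : ∀ i, Measurable fun q : Ω × (ℝ × ℝ) => W i q.1 q.2.2 := fun i =>
    (hW i).comp (measurable_fst.prodMk (measurable_snd.comp measurable_snd))
  let M : ℕ → Ω → ℝ≥0∞ := fun i ω => ∫⁻ x, W i ω x ∂ν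
  let E : ℕ → Ω → ℝ≥0∞ := fun i ω =>
    ∫⁻ p, posLogKernel R (p.1 - p.2) * (W i ω p.1 * W i ω p.2) ∂(ν.prod ν)
  have hMmeas : ∀ i, Measurable (M i) := fun i => (hW i).lintegral_prod_right'
  have hWE : ∀ i, Measurable fun q : Ω × (ℝ × ℝ) =>
      posLogKernel R (q.2.1 - q.2.2) * (W i q.1 q.2.1 * W i q.1 q.2.2) := fun i =>
    ((measurable_posLogKernel R).comp (hsub.comp measurable_snd)).mul ((hW1 i).mul (hW2 i))
  have hEmeas : ∀ i, Measurable (E i) := fun i => (hWE i).lintegral_prod_right'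
  have hM1 : ∀ i, ∫⁻ ω, M i ω ∂P = 1 := by
    intro i
    simp only [M]
    rw [lintegral_lintegral_swap (hW i).aemeasurable]
    calc _ = ∫⁻ _, 1 ∂ν := by
          refine lintegral_congr_ae ?_
          filter_upwards [hm] with x hx
          exact lintegral_cascadeDensity hc hind hlaw hl hb hmb hb1 hx i
      _ = 1 := by simp
  have hMM : ∀ i ω, M i ω * M i ω = ∫⁻ p, W i ω p.1 * W i ω p.2 ∂(ν.prod ν) := fun i ω =>
    (lintegral_prod_mul (hWω i ω).aemeasurable (hWω i ω).aemeasurable).symm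
  have hM2 : ∀ i, ∫⁻ ω, M i ω * M i ω ∂P ≤ 1 + ε := by
    intro i
    simp only [hMM]
    rw [lintegral_lintegral_swap ((hW1 i).mul (hW2 i)).aemeasurable]
    refine le_trans (lintegral_mono_ae ?_) (hbound1 i)
    filter_upwards [hgood] with p hp
    exact lintegral_cascadeDensity_mul_le hc hind hlaw hl hb hmb hb1 hp.1 hp.2 i
  have hE2 : ∀ i, ∫⁻ ω, E i ω ∂P ≤ V + 2 * ε := by
    intro i
    simp only [E]
    rw [lintegral_lintegral_swap (hWE i).aemeasurable]
    refine le_trans (lintegral_mono_ae ?_) (hbound2 i)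
    filter_upwards [hgood] with p hp
    have hmp : Measurable fun ω => W i ω p.1 * W i ω p.2 :=
      ((hW1 i).mul (hW2 i)).comp (measurable_id.prodMk (measurable_const (a := p)))
    rw [lintegral_const_mul _ hmp]
    gcongr
    exact lintegral_cascadeDensity_mul_le hc hind hlaw hl hb hmb hb1 hp.1 hp.2 i
  have hMtop : ∀ᵐ ω ∂P, ∀ i, M i ω ≠ ⊤ := by
    rw [ae_all_iff]
    intro i
    filter_upwards [ae_lt_top (hMmeas i) (by rw [hM1 i]; exact ENNReal.one_ne_top)] with ω hω
    exact hω.ne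
  have hclosed : ∀ ω i, IsClosed (cascadeSet l b (fun k => c k ω) i) := fun ω i =>
    isClosed_cascadeSet l b _ i
  have hnorm : ∀ i ω, M i ω ≠ 0 → M i ω ≠ ⊤ → ∃ μ : Measure ℝ, IsProbabilityMeasure μ ∧
      μ (Q ∩ cascadeSet l b (fun k => c k ω) i)ᶜ = 0 ∧
      posLogEnergy R μ = (M i ω)⁻¹ * (M i ω)⁻¹ * E i ω := fun i ω h0 ht =>
    exists_normalized_withDensity (hWω i ω) h0 ht hQ0 (hclosed ω i).measurableSet
      fun x hx => mem_cascadeSet_of_ne_zero hx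
  -- The normalised measure lives on a compact subset of `J`, so it competes in the definition of
  -- `V`.
  have hVE : ∀ i, ∀ᵐ ω ∂P, V * (M i ω * M i ω) ≤ E i ω := by
    intro i
    filter_upwards [hMtop] with ω hω
    rcases eq_or_ne (M i ω) 0 with h0 | h0
    · simp [h0]
    obtain ⟨μ, hμ1, hμ2, hμ3⟩ := hnorm i ω h0 (hω i)
    have hμJ : μ ∈ compactProbMeasures J := ⟨hμ1, Q ∩ cascadeSet l b (fun k => c k ω) i,
      hQ.inter_right (hclosed ω i), inter_subset_left.trans hQJ, hμ2⟩
    calc V * (M i ω * M i ω) ≤ ((M i ω)⁻¹ * (M i ω)⁻¹ * E i ω) * (M i ω * M i ω) := by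
          gcongr
          rw [← hμ3]
          exact hVle μ hμJ
      _ = ((M i ω)⁻¹ * M i ω) * ((M i ω)⁻¹ * M i ω) * E i ω := by ring
      _ = E i ω := by rw [ENNReal.inv_mul_cancel h0 (hω i), one_mul, one_mul]
  let B : ℕ → Set Ω := fun i => {ω | M i ω < 2⁻¹} ∪ {ω | V * (M i ω * M i ω) + ε' < E i ω}
  have hB : ∀ i, P (B i) ≤ 4 * ε + ε'⁻¹ * (2 * ε) := by
    intro i
    refine (measure_union_le _ _).trans (add_le_add (measure_lt_half_le (hMmeas i) (hM1 i) (hM2 i)) ?_)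
    have h := mul_measure_lt_le (ε' := ε') (hMmeas i) (hM1 i) (hEmeas i) hVtop (hVE i) (hE2 i)
    calc _ = ε'⁻¹ * (ε' * P {ω | V * (M i ω * M i ω) + ε' < E i ω}) := by
          rw [← mul_assoc, ENNReal.inv_mul_cancel hε' hε't, one_mul]
      _ ≤ _ := by gcongr
  -- The bad events need not be summable: infinitely many good stages suffice for the compactness
  -- argument, so only being eventually always bad has to be excluded.
  refine le_trans ?_ (measure_eventually_mem_le hB)
  refine measure_mono_ae ?_
  filter_upwards [hMtop] with ω hω hbad
  change ∀ᶠ i in atTop, ω ∈ B i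
  by_contra hfreq
  apply hbad
  have hfreq' : ∃ᶠ i in atTop, ω ∉ B i := not_eventually.1 hfreq
  have hex : ∃ᶠ i in atTop, ∃ μ : Measure ℝ, IsProbabilityMeasure μ ∧
      μ (Q ∩ cascadeSet l b (fun k => c k ω) i)ᶜ = 0 ∧ posLogEnergy R μ ≤ V + 4 * ε' := by
    refine hfreq'.mono fun i hi => ?_
    simp only [B, mem_union, not_or] at hi
    have h1 : 2⁻¹ ≤ M i ω := not_lt.1 hi.1
    have h2 : E i ω ≤ V * (M i ω * M i ω) + ε' := not_lt.1 hi.2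
    have h0 : M i ω ≠ 0 := (lt_of_lt_of_le (by simp) h1).ne'
    obtain ⟨μ, hμ1, hμ2, hμ3⟩ := hnorm i ω h0 (hω i)
    refine ⟨μ, hμ1, hμ2, ?_⟩
    have hinv : (M i ω)⁻¹ ≤ 2 := ENNReal.inv_le_iff_inv_le.1 h1
    calc posLogEnergy R μ ≤ (M i ω)⁻¹ * (M i ω)⁻¹ * (V * (M i ω * M i ω) + ε') := by
          rw [hμ3]; gcongr
      _ = V * ((M i ω)⁻¹ * M i ω) * ((M i ω)⁻¹ * M i ω) + (M i ω)⁻¹ * (M i ω)⁻¹ * ε' := by ring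
      _ = V + (M i ω)⁻¹ * (M i ω)⁻¹ * ε' := by
          rw [ENNReal.inv_mul_cancel h0 (hω i), mul_one, mul_one]
      _ ≤ V + 2 * 2 * ε' := by gcongr
      _ = V + 4 * ε' := by norm_num
  obtain ⟨μ, hμ1, hμ2, hμ3⟩ := exists_posLogEnergy_le_iInter hR (V + 4 * ε')
    (K := fun i => Q ∩ cascadeSet l b (fun k => c k ω) i)
    (fun i => hQ.inter_right (hclosed ω i))
    (fun i j hij => inter_subset_inter_right _ (antitone_cascadeSet l b _ hij)) hex
  refine ⟨μ, ⟨hμ1, _, ?_, ?_, hμ2⟩, hμ3⟩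
  · exact (hQ.inter_right (hclosed ω 0)).of_isClosed_subset
      (isClosed_iInter fun i => (hQ.inter_right (hclosed ω i)).isClosed) (iInter_subset _ 0)
  · refine Subset.trans ?_ (iInter_cascadeSet_subset hl hb fun k => c k ω)
    exact iInter_mono fun i => inter_subset_right

lemma iInf_posLogEnergy_ne_top {R : ℝ} (hR : 0 < R) {J : Set ℝ} (hJ : J.OrdConnected)
    (hJn : J.Nontrivial) : ⨅ μ ∈ compactProbMeasures J, posLogEnergy R μ ≠ ⊤ := by
  obtain ⟨a, ha, b, hb, hab⟩ := hJn.exists_lt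
  have hU := isProbabilityMeasure_uniformIcc hab
  have hmem : uniformIcc a b ∈ compactProbMeasures J :=
    ⟨hU, Icc a b, isCompact_Icc, hJ.out ha hb, ae_mem_uniformIcc a b⟩
  refine ne_top_of_le_ne_top (posLogEnergy_ne_top hR (ENNReal.inv_ne_top.2 ?_) (uniformIcc_le a b))
    (iInf₂_le _ hmem)
  simpa using hab

/-- Almost surely the limsup set carries measures of energy at most `V + 4 * ε'`, where `V` is the
minimal energy on `J`. -/
lemma ae_exists_posLogEnergy_le {Ω : Type*} [MeasurableSpace Ω] {P : Measure Ω}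
    [IsProbabilityMeasure P] {c : ℕ → Ω → ℝ} {ρ : Measure ℝ} [IsFiniteMeasure ρ] {l : ℕ → ℝ}
    (hc : ∀ k, Measurable (c k)) (hind : iIndepFun c P)
    (hlaw : ∀ k, P.map (c k) = ρ) (hl : ∀ k, 0 < l k) (hl0 : Tendsto l atTop (𝓝 0))
    {R : ℝ} (hR : 0 < R) {A : ℝ≥0∞} (hAtop : A ≠ ⊤)
    (hA : ∀ k, 1 ≤ k → ENNReal.ofReal (Real.log (R / (l k / 2))) + 1 ≤ A * k)
    {J : Set ℝ} (hJo : J.OrdConnected) (hJn : J.Nontrivial)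
    (hJ : ∀ x ∈ J, ∀ y ∈ J, 1 ≤ posLogKernel R (x - y))
    (hρ : ρ ≪ volume) (hρJ : volume.restrict J ≪ ρ) {ε' : ℝ≥0∞} (hε' : ε' ≠ 0) (hε't : ε' ≠ ⊤) :
    ∀ᵐ ω ∂P, ∃ μ ∈ compactProbMeasures (limsupIntervals (fun k => c k ω) l),
      posLogEnergy R μ ≤ (⨅ μ ∈ compactProbMeasures J, posLogEnergy R μ) + 4 * ε' := by
  have hV := iInf_posLogEnergy_ne_top hR hJo hJn
  set V := ⨅ μ ∈ compactProbMeasures J, posLogEnergy R μ with hVdef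
  -- The event does not depend on `ε`, although `ν`, `m` and the blocks do; with `ε'` fixed, letting
  -- `ε` tend to 0 shows that it is null.
  have key : ∀ ε : ℝ≥0∞, ε ≠ 0 →
      P {ω | ¬ ∃ μ ∈ compactProbMeasures (limsupIntervals (fun k => c k ω) l),
        posLogEnergy R μ ≤ V + 4 * ε'} ≤ 4 * ε + ε'⁻¹ * (2 * ε) := by
    intro ε hε
    have hlt : V < V + ε := ENNReal.lt_add_right hV hε
    obtain ⟨μ₀, hlt'⟩ := iInf_lt_iff.1 (hVdef.symm.trans_lt hlt)
    obtain ⟨hμ₀, hμ₀lt⟩ := iInf_lt_iff.1 hlt'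
    obtain ⟨μ₁, hμ₁, D₁, hD₁, hμD₁, hlt₁⟩ :=
      exists_bounded_density_posLogEnergy_lt hR hJo hJn hμ₀ hμ₀lt
    have hac : μ₁ ≪ ρ := by
      refine Measure.AbsolutelyContinuous.trans ?_ hρJ
      have h1 : μ₁ ≪ volume :=
        (Measure.absolutelyContinuous_of_le hμD₁).trans Measure.smul_absolutelyContinuous
      obtain ⟨_, K, _, hKJ, h0⟩ := hμ₁
      have h2 : μ₁.restrict J = μ₁ :=
        Measure.restrict_eq_self_of_ae_mem (measure_mono_null (compl_subset_compl.2 hKJ) h0)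
      rw [← h2]
      exact h1.restrict J
    obtain ⟨ν, hν, D, hD, hνD, ⟨m, hm⟩, hlt₂⟩ :=
      exists_lowerDensitySet_posLogEnergy_lt hρ hac hμ₁ hD₁ hμD₁ hl hl0 hlt₁
    exact measure_not_exists_posLogEnergy_le hc hind hlaw hl hR hAtop hA hJ hν hD hνD hm hε hε' hε't
      hlt₂.le
  have hlim : Tendsto (fun n : ℕ => 4 * (n : ℝ≥0∞)⁻¹ + ε'⁻¹ * (2 * (n : ℝ≥0∞)⁻¹)) atTop (𝓝 0) := by
    have h0 := ENNReal.tendsto_inv_nat_nhds_zero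
    have h1 := ENNReal.Tendsto.const_mul (a := 4) h0 (Or.inr (by simp))
    have h2 := ENNReal.Tendsto.const_mul (a := 2) h0 (Or.inr (by simp))
    have h3 := ENNReal.Tendsto.const_mul (a := ε'⁻¹) h2 (Or.inr (ENNReal.inv_ne_top.2 hε'))
    simpa using h1.add h3
  exact le_antisymm (ge_of_tendsto' hlim fun n => key _ (by simp)) bot_le

/-! ### Inclusion in the interval and conclusion -/

/-- A point lies almost surely in only finitely many of the random intervals. -/
lemma ae_notMem_limsupIntervals {Ω : Type*} [MeasurableSpace Ω] {P : Measure Ω}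
    {c : ℕ → Ω → ℝ} {ρ : Measure ℝ} {l : ℕ → ℝ}
    (hc : ∀ k, Measurable (c k)) (hlaw : ∀ k, P.map (c k) = ρ)
    (hsum : Summable l) {D : ℝ≥0∞} (hD : D ≠ ⊤) (hρ : ρ ≤ D • volume) (p : ℝ) :
    ∀ᵐ ω ∂P, p ∉ limsupIntervals (fun k => c k ω) l := by
  have hbound : ∀ k, P {ω | c k ω ∈ Metric.ball p (l k / 2)} ≤ D * ENNReal.ofReal (l k) := by
    intro k
    have h1 : P {ω | c k ω ∈ Metric.ball p (l k / 2)} = ρ (Metric.ball p (l k / 2)) := by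
      rw [← hlaw k, Measure.map_apply (hc k) Metric.isOpen_ball.measurableSet]
      rfl
    rw [h1]
    refine (hρ _).trans (le_of_eq ?_)
    rw [Measure.smul_apply, smul_eq_mul, Real.volume_ball]
    congr 2
    ring
  have hfin : ∑' k, P {ω | c k ω ∈ Metric.ball p (l k / 2)} ≠ ⊤ := by
    refine ne_top_of_le_ne_top ?_ (ENNReal.tsum_le_tsum hbound)
    rw [ENNReal.tsum_mul_left]
    exact ENNReal.mul_ne_top hD hsum.tsum_ofReal_ne_top
  filter_upwards [ae_eventually_notMem hfin] with ω hω hp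
  obtain ⟨m, hm⟩ := eventually_atTop.1 hω
  obtain ⟨k, hk, hpk⟩ := mem_iUnion₂.1 (mem_iInter.1 hp m)
  refine hm k hk ?_
  have h1 := hpk.1
  have h2 := hpk.2
  simp only [Metric.mem_ball, Real.dist_eq, abs_lt]
  constructor <;> linarith

/-- Points of the limsup set are within any distance of some center, hence between the infimum and
the supremum of `J`; only these two endpoints can fail to belong to `J`. -/
lemma limsupIntervals_subset_of_mem {J : Set ℝ} (hJ : J.OrdConnected) (hJb : Bornology.IsBounded J)
    {c l : ℕ → ℝ} (hl0 : Tendsto l atTop (𝓝 0)) (hc : ∀ k, c k ∈ J)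
    (h1 : sInf J ∉ limsupIntervals c l) (h2 : sSup J ∉ limsupIntervals c l) :
    limsupIntervals c l ⊆ J := by
  intro x hx
  have hclose : ∀ δ > 0, ∃ k, |x - c k| < δ := by
    intro δ hδ
    obtain ⟨m, hm⟩ := eventually_atTop.1 (hl0.eventually_lt_const hδ)
    obtain ⟨k, hk, hxk⟩ := mem_iUnion₂.1 (mem_iInter.1 hx m)
    have h3 := hm k hk
    have h4 := hxk.1
    have h5 := hxk.2
    exact ⟨k, abs_lt.2 ⟨by linarith, by linarith⟩⟩
  have hne : J.Nonempty := ⟨c 0, hc 0⟩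
  have ha : sInf J < x := by
    refine lt_of_le_of_ne (le_of_forall_pos_le_add fun δ hδ => ?_) (by rintro rfl; exact h1 hx)
    obtain ⟨k, hk⟩ := hclose δ hδ
    have := csInf_le hJb.bddBelow (hc k)
    linarith [(abs_lt.1 hk).1]
  have hb : x < sSup J := by
    refine lt_of_le_of_ne (le_of_forall_pos_le_add fun δ hδ => ?_) (by rintro rfl; exact h2 hx)
    obtain ⟨k, hk⟩ := hclose δ hδ
    have := le_csSup hJb.bddAbove (hc k)
    linarith [(abs_lt.1 hk).2]
  obtain ⟨u, hu, hux⟩ := exists_lt_of_csInf_lt hne ha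
  obtain ⟨v, hv, hxv⟩ := exists_lt_of_lt_csSup hne hb
  exact hJ.out hu hv ⟨hux.le, hxv.le⟩

theorem mainTheorem3 {Ω : Type*} [MeasurableSpace Ω] (P : Measure Ω) [IsProbabilityMeasure P]
    (J : Set ℝ) (hJ_interval : J.OrdConnected) (hJ_bounded : Bornology.IsBounded J)
    (hJ_nontrivial : J.Nontrivial)
    (f : ℝ → ℝ) (M : ℝ)
    (hf_meas : AEMeasurable f (volume.restrict J))
    (hf_pos : ∀ᵐ x ∂(volume.restrict J), 0 < f x)
    (hf_le : ∀ᵐ x ∂(volume.restrict J), f x ≤ M)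
    (c : ℕ → Ω → ℝ)
    (hc_meas : ∀ k, AEMeasurable (c k) P)
    (hc_indep : iIndepFun c P)
    (hc_law : ∀ k, P.map (c k) =
      (volume.restrict J).withDensity (fun x => ENNReal.ofReal (f x)))
    (lam : ℝ) (hlam : 0 < lam) :
    ∀ᵐ ω ∂P,
      HasFullCapacity
        (Complex.ofReal '' limsupIntervals (fun k => c k ω) (fun k => Real.exp (-lam * k)))
        (Complex.ofReal '' J) ∧
      0 < logCapacity (Complex.ofReal '' J) := by
  set ρ := (volume.restrict J).withDensity (fun x => ENNReal.ofReal (f x)) with hρdef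
  set l : ℕ → ℝ := fun k => Real.exp (-lam * k) with hldef
  have hJm : MeasurableSet J := hJ_interval.measurableSet
  have hρprob : IsProbabilityMeasure ρ := by
    rw [← hc_law 0]
    exact Measure.isProbabilityMeasure_map (hc_meas 0)
  have hρle : ρ ≤ ENNReal.ofReal M • volume := by
    calc ρ ≤ (volume.restrict J).withDensity (fun _ => ENNReal.ofReal M) := by
          refine withDensity_mono ?_
          filter_upwards [hf_le] with x hx
          exact ENNReal.ofReal_le_ofReal hx
      _ = ENNReal.ofReal M • volume.restrict J := withDensity_const _
      _ ≤ _ := smul_le_smul_left _ Measure.restrict_le_self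
  have hρac : ρ ≪ volume :=
    (Measure.absolutelyContinuous_of_le hρle).trans Measure.smul_absolutelyContinuous
  have hρJ : volume.restrict J ≪ ρ := by
    refine withDensity_absolutelyContinuous' hf_meas.ennreal_ofReal ?_
    filter_upwards [hf_pos] with x hx
    exact (ENNReal.ofReal_pos.2 hx).ne'
  have hρmem : ∀ᵐ x ∂ρ, x ∈ J :=
    (withDensity_absolutelyContinuous _ _).ae_le (ae_restrict_mem hJm)
  have hl : ∀ k, 0 < l k := fun k => Real.exp_pos _
  have hlsum : Summable l := by
    refine (Real.summable_exp_nat_mul_iff.2 (neg_lt_zero.2 hlam)).congr fun k => ?_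
    simp only [hldef]
    rw [mul_comm]
  have hl0 : Tendsto l atTop (𝓝 0) := hlsum.tendsto_atTop_zero
  -- The centers are replaced by measurable versions, with the same law and independence and almost
  -- surely the same limsup set.
  let c' : ℕ → Ω → ℝ := fun k => (hc_meas k).mk (c k)
  have hcc' : ∀ k, c k =ᵐ[P] c' k := fun k => (hc_meas k).ae_eq_mk
  have hc' : ∀ k, Measurable (c' k) := fun k => (hc_meas k).measurable_mk
  have hind : iIndepFun c' P := hc_indep.congr hcc'
  have hlaw : ∀ k, P.map (c' k) = ρ := fun k => by
    rw [← Measure.map_congr (hcc' k)]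
    exact hc_law k
  set d := Metric.diam J with hd
  have hd0 : 0 ≤ d := Metric.diam_nonneg
  have hdJ : ∀ x ∈ J, ∀ y ∈ J, |x - y| ≤ d := fun x hx y hy =>
    Metric.dist_le_diam_of_mem hJ_bounded hx hy
  -- The factor `e` makes `R / |x - y| ≥ e` off the diagonal of `J`, so that the kernel is at least
  -- 1 there.
  set R := Real.exp 1 * (d + 1) with hRdef
  have he : 1 ≤ Real.exp 1 := Real.one_le_exp zero_le_one
  have hR1 : 1 ≤ R := by nlinarith
  have hdR : d ≤ R := by nlinarith
  have hR0 : 0 < R := by linarith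
  have hJR : ∀ x ∈ J, ∀ y ∈ J, |x - y| ≤ R := fun x hx y hy => (hdJ x hx y hy).trans hdR
  have hker : ∀ x ∈ J, ∀ y ∈ J, 1 ≤ posLogKernel R (x - y) := by
    intro x hx y hy
    rcases eq_or_ne (x - y) 0 with h0 | h0
    · simp [h0]
    have hpos := abs_pos.2 h0
    rw [posLogKernel_of_ne h0, ENNReal.one_le_ofReal, Real.le_log_iff_exp_le (by positivity),
      le_div_iff₀ hpos]
    have := hdJ x hx y hy
    exact mul_le_mul_of_nonneg_left (by linarith) (Real.exp_pos 1).le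
  -- The exponential lengths enter here: `log (2 * R / l k) = log (2 * R) + lam * k`, which is at
  -- most `(log (2 * R) + lam) * k` for `k ≥ 1`.
  set A : ℝ≥0∞ := ENNReal.ofReal (Real.log (2 * R) + lam) + 1 with hAdef
  have hA : ∀ k : ℕ, 1 ≤ k → ENNReal.ofReal (Real.log (R / (l k / 2))) + 1 ≤ A * k := by
    intro k hk
    have hk1 : (1 : ℝ) ≤ k := by exact_mod_cast hk
    have hlog2 : 0 ≤ Real.log (2 * R) := Real.log_nonneg (by linarith)
    have h1 : Real.log (R / (l k / 2)) = Real.log (2 * R) + lam * k := by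
      rw [show R / (l k / 2) = 2 * R / l k by field_simp, Real.log_div (by positivity) (hl k).ne']
      simp only [hldef, Real.log_exp]
      ring
    rw [h1, hAdef, add_mul, one_mul, ← ENNReal.ofReal_natCast, ← ENNReal.ofReal_mul (by positivity)]
    refine add_le_add (ENNReal.ofReal_le_ofReal (by nlinarith)) ?_
    rw [ENNReal.one_le_ofReal]
    exact hk1
  have hmeas : ∀ᵐ ω ∂P, ∀ n : ℕ, ∃ μ ∈ compactProbMeasures (limsupIntervals (fun k => c' k ω) l),
      posLogEnergy R μ ≤ (⨅ μ ∈ compactProbMeasures J, posLogEnergy R μ) +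
        4 * ((n + 1 : ℕ) : ℝ≥0∞)⁻¹ := by
    rw [ae_all_iff]
    intro n
    exact ae_exists_posLogEnergy_le hc' hind hlaw hl hl0 hR0
      (ENNReal.add_ne_top.2 ⟨ENNReal.ofReal_ne_top, ENNReal.one_ne_top⟩) hA hJ_interval hJ_nontrivial
      hker hρac hρJ (by simp) (ENNReal.inv_ne_top.2 (by exact_mod_cast n.succ_ne_zero))
  have hmem : ∀ᵐ ω ∂P, ∀ k, c' k ω ∈ J := by
    rw [ae_all_iff]
    intro k
    rw [← hlaw k] at hρmem
    exact ae_of_ae_map (hc' k).aemeasurable hρmem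
  filter_upwards [hmeas, hmem, ae_all_iff.2 hcc',
    ae_notMem_limsupIntervals hc' hlaw hlsum ENNReal.ofReal_ne_top hρle (sInf J),
    ae_notMem_limsupIntervals hc' hlaw hlsum ENNReal.ofReal_ne_top hρle (sSup J)]
    with ω h1 h2 h3 h4 h5
  have hcω : (fun k => c k ω) = fun k => c' k ω := funext h3
  rw [hcω]
  refine ⟨hasFullCapacity_of_iInf_le hR1 hJR
    (limsupIntervals_subset_of_mem hJ_interval hJ_bounded hl0 h2 h4 h5) ?_,
    logCapacity_image_ofReal_pos hR1 hJR (iInf_posLogEnergy_ne_top hR0 hJ_interval hJ_nontrivial)⟩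
  have hlim : Tendsto (fun n : ℕ => (⨅ μ ∈ compactProbMeasures J, posLogEnergy R μ) +
      4 * ((n + 1 : ℕ) : ℝ≥0∞)⁻¹) atTop (𝓝 (⨅ μ ∈ compactProbMeasures J, posLogEnergy R μ)) := by
    have h6 := (ENNReal.Tendsto.const_mul (a := 4) ENNReal.tendsto_inv_nat_nhds_zero
      (Or.inr (by simp))).comp (tendsto_add_atTop_nat 1)
    simpa using (tendsto_const_nhds
      (x := ⨅ μ ∈ compactProbMeasures J, posLogEnergy R μ)).add h6
  refine ge_of_tendsto' hlim fun n => ?_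
  obtain ⟨μ, hμ, hle⟩ := h1 n
  exact (iInf₂_le μ hμ).trans hle
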